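/- Let $D$ be a totally ordered (commutative, unital) integral domain. A *de Vries algebra* is a pair $(B,\prec)$, where $B$ is a complete boolean algebra and $\prec$ is a de Vries proximity on $B$: $1\prec 1$; $a\prec b$ implies $a\le b$; $a\le b\prec c\le d$ implies $a\prec d$; $a\prec b,c$ implies $a\prec b\wedge c$; $a\prec b$ implies $\neg b\prec\neg a$; $a\prec b$ implies $a\prec c\prec b$ for some $c$; and for each $a\ne 0$ there is $b\neq 0$ with $b\prec a$. A *de Vries morphism* is a map $\sigma:A\to B$ between de Vries algebras with $\sigma(0)=0$, $\sigma(a\wedge b)=\sigma(a)\wedge\sigma(b)$, $\neg\sigma(\neg a)\prec\sigma(b)$ whenever $a\prec b$, and $\sigma(b)=\bigvee\{\sigma(a):a\prec b\}$. A *Specker $D$-algebra* is a commutative unital $D$-algebra that is generated as a $D$-algebra by its idempotents and is torsion-free as a $D$-module; it carries exactly one partial order making it an $f$-algebra over $D$ (a lattice-ordered ring in which $as\ge 0$ for $0\le a\in D$, $s\ge 0$, and in which $s\wedge t=0$, $r\ge0$ imply $rs\wedge t=0$). It is a *Baer-Specker $D$-algebra* if the annihilator of every ideal is generated by an idempotent.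 A *proximity* on it is a relation $\lhd$ such that: $0\lhd0$ and $1\lhd1$; $s\lhd t$ implies $s\le t$; $s\le t\lhd r\le u$ implies $s\lhd u$; $s\lhd t,r$ implies $s\lhd t\wedge r$; $s\lhd t$ implies $-t\lhd -s$; $s\lhd t$ and $r\lhd u$ imply $s+r\lhd t+u$; for $0<a\in D$, $s\lhd t$ iff $as\lhd at$; for $s,t,r,u\ge0$, $s\lhd t$ and $r\lhd u$ imply $sr\lhd tu$; $s\lhd t$ implies $s\lhd r\lhd t$ for some $r$; and $s>0$ implies $t\lhd s$ for some $t>0$. A *proximity morphism* $\alpha:(S,\lhd)\to(T,\lhd)$ is a map with $\alpha(0)=0$; $\alpha(s\wedge t)=\alpha(s)\wedge\alpha(t)$; $-\alpha(-s)\lhd\alpha(t)$ whenever $s\lhd t$; $\alpha(t)$ is the least upper bound of $\{\alpha(s):s\lhd t\}$; and $\alpha(s+a\cdot 1)=\alpha(s)+a\cdot 1$, $\alpha(s\vee a\cdot 1)=\alpha(s)\vee a\cdot 1$ for $a\in D$, and $\alpha(as)=a\alpha(s)$ for $0\le a\in D$. Then de Vries algebras and de Vries morphisms form a category $\mathsf{DeV}$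 with composition $(\sigma_2\star\sigma_1)(b)=\bigvee\{\sigma_2\sigma_1(a):a\prec b\}$; proximity Baer-Specker $D$-algebras and proximity morphisms form a category $\mathsf{PBSp}_D$ with composition $(\alpha_2\star\alpha_1)(t)=\bigvee\{\alpha_2\alpha_1(s):s\lhd t\}$ (the least upper bound exists); in both categories the identities are the identity maps; and the categories $\mathsf{PBSp}_D$ and $\mathsf{DeV}$ are equivalent. The equivalence is given by the following functors. The functor $\mathrm{Id}:\mathsf{PBSp}_D\to\mathsf{DeV}$ sends $(S,\lhd)$ to the boolean algebra of idempotents of $S$ with the restriction of $\lhd$, and a proximity morphism to its restriction to idempotents. The functor $\mathsf{DeV}\to\mathsf{PBSp}_D$ sends $(B,\prec)$ to its de Vries power $(D[B]^\flat,\prec^\flat)$ and a de Vries morphism $\sigma$ to $f\mapsto\sigma\circ f$. Here $D[B]^\flat$ is the set of all $f:D\to B$ for which there are $a_0<\dots<a_n$ in $D$ and $1=e_0\ge e_1\ge\dots\ge e_n$ in $B$ with $f(a)=1$ for $a\le a_0$, $f(a)=e_i$ for $a_{i-1}<a\le a_i$, and $f(a)=0$ for $a>a_n$; it is ordered pointwise;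 $f\prec^\flat g$ means $f(a)\prec g(a)$ for all $a\in D$; and its $D$-algebra structure is carried over, along the bijection $g\mapsto\big(a\mapsto\bigvee_{b\ge a}g(b)\big)$, from the boolean power $D[B]^*$ of all finitely-valued $g:D\to B$ with $g(a)\wedge g(b)=0$ for $a\ne b$ and $\bigvee_{a}g(a)=1$, with operations $(f+g)(a)=\bigvee_{b+c=a}f(b)\wedge g(c)$, $(fg)(a)=\bigvee_{bc=a}f(b)\wedge g(c)$, $(bf)(a)=\bigvee_{bc=a}f(c)$. -/

import Mathlib

universe u v w

/-! ## Categories with a prescribed composition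

In both categories below the morphisms are certain maps, but the composition is not the
composition of maps: it is prescribed by a formula, and that the formula defines a morphism and
satisfies the laws of a category is part of what is claimed. -/

/-- A category structure on `Obj` whose morphisms are `Hom`, whose identities satisfy `IsId`, and
in which the composite `h` of `f : A ⟶ B` and `g : B ⟶ C` satisfies `IsComp f g h`. -/
structure CategoryOn {Obj : Type u} (Hom : Obj → Obj → Type v)
    (IsId : ∀ {A : Obj}, Hom A A → Prop)
    (IsComp : ∀ {A B C : Obj}, Hom A B → Hom B C → Hom A C → Prop) where
  /-- the identities -/
  id : ∀ A : Obj, Hom A A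
  isId_id : ∀ A : Obj, IsId (id A)
  /-- the composition, in diagrammatic order -/
  comp : ∀ {A B C : Obj}, Hom A B → Hom B C → Hom A C
  isComp_comp : ∀ {A B C : Obj} (f : Hom A B) (g : Hom B C), IsComp f g (comp f g)
  id_comp : ∀ {A B : Obj} (f : Hom A B), comp (id A) f = f
  comp_id : ∀ {A B : Obj} (f : Hom A B), comp f (id B) = f
  assoc : ∀ {A B C E : Obj} (f : Hom A B) (g : Hom B C) (h : Hom C E),
    comp (comp f g) h = comp f (comp g h)

/-- The corresponding Mathlib category. -/
@[reducible] def CategoryOn.toCategory {Obj : Type u} {Hom : Obj → Obj → Type v}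
    {IsId : ∀ {A : Obj}, Hom A A → Prop}
    {IsComp : ∀ {A B C : Obj}, Hom A B → Hom B C → Hom A C → Prop}
    (c : CategoryOn Hom IsId IsComp) : CategoryTheory.Category.{v} Obj where
  Hom := Hom
  id := c.id
  comp := fun f g => c.comp f g
  id_comp := fun f => c.id_comp f
  comp_id := fun f => c.comp_id f
  assoc := fun f g h => c.assoc f g h

/-! ## De Vries algebras -/

/-- De Vries proximities on a boolean algebra. -/
structure IsDeVriesProximity {B : Type w} [BooleanAlgebra B] (prox : B → B → Prop) : Prop where
  top_prox : prox ⊤ ⊤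
  le_of_prox : ∀ {a b : B}, prox a b → a ≤ b
  mono : ∀ {a b c d : B}, a ≤ b → prox b c → c ≤ d → prox a d
  inf_right : ∀ {a b c : B}, prox a b → prox a c → prox a (b ⊓ c)
  compl : ∀ {a b : B}, prox a b → prox bᶜ aᶜ
  interpolate : ∀ {a b : B}, prox a b → ∃ c : B, prox a c ∧ prox c b
  exists_prox : ∀ {a : B}, a ≠ ⊥ → ∃ b : B, b ≠ ⊥ ∧ prox b a

/-- A de Vries algebra: a complete boolean algebra with a de Vries proximity. -/
structure DeV : Type (w + 1) where
  /-- the underlying set -/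
  carrier : Type w
  [completeBooleanAlgebra : CompleteBooleanAlgebra carrier]
  /-- the proximity -/
  prox : carrier → carrier → Prop
  isDeVriesProximity : IsDeVriesProximity prox

instance : CoeSort DeV.{w} (Type w) := ⟨DeV.carrier⟩

instance (A : DeV.{w}) : CompleteBooleanAlgebra A := A.completeBooleanAlgebra

/-- De Vries morphisms. -/
@[ext] structure DeV.Hom (A B : DeV.{w}) : Type w where
  /-- the underlying map -/
  toFun : A → B
  map_bot : toFun ⊥ = ⊥
  map_inf : ∀ a b : A, toFun (a ⊓ b) = toFun a ⊓ toFun b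
  map_prox : ∀ {a b : A}, A.prox a b → B.prox (toFun aᶜ)ᶜ (toFun b)
  map_sSup : ∀ b : A, toFun b = sSup (toFun '' {a : A | A.prox a b})

instance (A B : DeV.{w}) : CoeFun (DeV.Hom A B) (fun _ => A → B) := ⟨DeV.Hom.toFun⟩

/-- The identity morphism is the identity map. -/
def DeV.IsId {A : DeV.{w}} (f : DeV.Hom A A) : Prop :=
  ∀ a : A, f a = a

/-- `h` is the composite `g ⋆ f`, that is, `h b = ⋁ {g (f a) : a ≺ b}`. -/
def DeV.IsComp {A B C : DeV.{w}} (f : DeV.Hom A B) (g : DeV.Hom B C) (h : DeV.Hom A C) : Prop :=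
  ∀ b : A, h b = sSup ((fun a : A => g (f a)) '' {a : A | A.prox a b})

/-- The structure of the category of de Vries algebras. There is at most one, since a morphism is
determined by its underlying map. -/
abbrev DeV.CategoryStructure : Type (w + 1) :=
  CategoryOn DeV.Hom.{w} DeV.IsId.{w} DeV.IsComp.{w}

/-! ## Proximity Baer-Specker algebras -/

section Algebras

variable (D : Type u) [CommRing D] [LinearOrder D]

/-- A commutative `D`-algebra that is idempotent-generated and torsion-free as a `D`-module. -/
structure IsSpeckerAlgebra (S : Type w) [CommRing S] [Algebra D S] : Prop where
  adjoin_eq_top : Algebra.adjoin D {e : S | IsIdempotentElem e} = ⊤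
  torsionFree : Module.IsTorsionFree D S

/-- The annihilator of each ideal is generated by an idempotent. -/
def IsBaerRing (S : Type w) [CommRing S] : Prop :=
  ∀ I : Ideal S, ∃ e : S, IsIdempotentElem e ∧ Submodule.annihilator I = Ideal.span {e}

/-- `S` is an `f`-algebra over `D`. -/
structure IsFAlgebra (S : Type w) [CommRing S] [Algebra D S] [Lattice S] : Prop where
  add_le_add_right : ∀ {s t : S}, s ≤ t → ∀ r : S, s + r ≤ t + r
  mul_nonneg : ∀ {s t : S}, 0 ≤ s → 0 ≤ t → 0 ≤ s * t
  mul_inf_eq_zero : ∀ {r s t : S}, s ⊓ t = 0 → 0 ≤ r → (r * s) ⊓ t = 0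
  smul_nonneg : ∀ {a : D} {s : S}, 0 ≤ a → 0 ≤ s → 0 ≤ a • s

/-- Proximities on an `f`-algebra over `D`. -/
structure IsProximity {S : Type w} [CommRing S] [Algebra D S] [Lattice S]
    (prox : S → S → Prop) : Prop where
  zero_prox : prox 0 0
  one_prox : prox 1 1
  le_of_prox : ∀ {s t : S}, prox s t → s ≤ t
  mono : ∀ {s t r u : S}, s ≤ t → prox t r → r ≤ u → prox s u
  inf_right : ∀ {s t r : S}, prox s t → prox s r → prox s (t ⊓ r)
  neg : ∀ {s t : S}, prox s t → prox (-t) (-s)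
  add : ∀ {s t r u : S}, prox s t → prox r u → prox (s + r) (t + u)
  smul : ∀ {s t : S}, prox s t → ∀ a : D, 0 < a → prox (a • s) (a • t)
  of_smul : ∀ {s t : S} (a : D), 0 < a → prox (a • s) (a • t) → prox s t
  mul : ∀ {s t r u : S}, 0 ≤ s → 0 ≤ t → 0 ≤ r → 0 ≤ u →
    prox s t → prox r u → prox (s * r) (t * u)
  interpolate : ∀ {s t : S}, prox s t → ∃ r : S, prox s r ∧ prox r t
  exists_prox : ∀ {s : S}, 0 < s → ∃ t : S, 0 < t ∧ prox t s

/-- A proximity Baer-Specker `D`-algebra: a Specker `D`-algebra that is a Baer ring, with its order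
as an `f`-algebra over `D` (a Specker `D`-algebra has exactly one), and with a proximity. -/
structure PBSp : Type (max u (w + 1)) where
  /-- the underlying set -/
  carrier : Type w
  [commRing : CommRing carrier]
  [algebra : Algebra D carrier]
  [lattice : Lattice carrier]
  isSpeckerAlgebra : IsSpeckerAlgebra D carrier
  isFAlgebra : IsFAlgebra D carrier
  isBaerRing : IsBaerRing carrier
  /-- the proximity -/
  prox : carrier → carrier → Prop
  isProximity : IsProximity D prox

end Algebras

section Morphisms

variable {D : Type u} [CommRing D] [LinearOrder D]

instance : CoeSort (PBSp.{u, w} D) (Type w) := ⟨PBSp.carrier⟩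

instance (S : PBSp.{u, w} D) : CommRing S := S.commRing

instance (S : PBSp.{u, w} D) : Algebra D S := S.algebra

instance (S : PBSp.{u, w} D) : Lattice S := S.lattice

/-- Proximity morphisms. -/
@[ext] structure PBSp.Hom (S T : PBSp.{u, w} D) : Type w where
  /-- the underlying map -/
  toFun : S → T
  map_zero : toFun 0 = 0
  map_inf : ∀ s t : S, toFun (s ⊓ t) = toFun s ⊓ toFun t
  map_prox : ∀ {s t : S}, S.prox s t → T.prox (-toFun (-s)) (toFun t)
  map_isLUB : ∀ t : S, IsLUB (toFun '' {s : S | S.prox s t}) (toFun t)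
  map_add_algebraMap : ∀ (s : S) (a : D),
    toFun (s + algebraMap D S a) = toFun s + algebraMap D T a
  map_smul : ∀ (a : D) (s : S), 0 ≤ a → toFun (a • s) = a • toFun s
  map_sup_algebraMap : ∀ (s : S) (a : D),
    toFun (s ⊔ algebraMap D S a) = toFun s ⊔ algebraMap D T a

instance (S T : PBSp.{u, w} D) : CoeFun (PBSp.Hom S T) (fun _ => S → T) := ⟨PBSp.Hom.toFun⟩

/-- The identity morphism is the identity map. -/
def PBSp.IsId {S : PBSp.{u, w} D} (f : PBSp.Hom S S) : Prop :=
  ∀ s : S, f s = s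

/-- `h` is the composite `g ⋆ f`, that is, `h t` is the least upper bound of
`{g (f s) : s ⊲ t}`. -/
def PBSp.IsComp {S T U : PBSp.{u, w} D} (f : PBSp.Hom S T) (g : PBSp.Hom T U)
    (h : PBSp.Hom S U) : Prop :=
  ∀ t : S, IsLUB ((fun s : S => g (f s)) '' {s : S | S.prox s t}) (h t)

end Morphisms

/-- The structure of the category of proximity Baer-Specker `D`-algebras. There is at most one,
since a morphism is determined by its underlying map and least upper bounds are unique. -/
abbrev PBSp.CategoryStructure (D : Type u) [CommRing D] [LinearOrder D] : Type (max u (w + 1)) :=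
  CategoryOn (PBSp.Hom (D := D)) (PBSp.IsId.{u, w} (D := D)) (PBSp.IsComp.{u, w} (D := D))

/-! ## Boolean powers and de Vries powers -/

section Powers

variable {D : Type u} [CommRing D] [LinearOrder D] {B : Type w} [CompleteBooleanAlgebra B]

/-- `f` belongs to the boolean power `D[B]^*`: it has finitely many values, `f a ⊓ f b = ⊥` for
`a ≠ b`, and the join of its values is `⊤`. -/
structure IsBooleanPowerElem (f : D → B) : Prop where
  finite_range : (Set.range f).Finite
  inf_eq_bot : ∀ {a b : D}, a ≠ b → f a ⊓ f b = ⊥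
  iSup_eq_top : ⨆ a : D, f a = ⊤

/-- Addition in `D[B]^*`. -/
def booleanPowerAdd (f g : D → B) : D → B :=
  fun a => ⨆ (b : D) (c : D) (_ : b + c = a), f b ⊓ g c

/-- Multiplication in `D[B]^*`. -/
def booleanPowerMul (f g : D → B) : D → B :=
  fun a => ⨆ (b : D) (c : D) (_ : b * c = a), f b ⊓ g c

/-- Multiplication by scalars in `D[B]^*`. -/
def booleanPowerSMul (b : D) (f : D → B) : D → B :=
  fun a => ⨆ (c : D) (_ : b * c = a), f c

/-- The correspondence from `D[B]^*` to `D[B]^♭`. -/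
def toFlat (f : D → B) : D → B :=
  fun a => ⨆ (b : D) (_ : a ≤ b), f b

/-- `f` belongs to `D[B]^♭`: it is a decreasing step function with values
`⊤ = e 0 ≥ e 1 ≥ ⋯ ≥ e n` and `⊥`, and with jumps at `a 0 < a 1 < ⋯ < a n`.

If `B` is nontrivial, then equal values can be merged and values `⊥` dropped, so that the same
functions are obtained when one requires `e 0 > e 1 > ⋯ > e n > ⊥`. -/
def IsFlatPowerElem (f : D → B) : Prop :=
  ∃ (n : ℕ) (e : Fin (n + 1) → B) (a : Fin (n + 1) → D),
    e 0 = ⊤ ∧ Antitone e ∧ StrictMono a ∧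
    (∀ x : D, x ≤ a 0 → f x = ⊤) ∧
    (∀ (i : Fin n) (x : D), a i.castSucc < x → x ≤ a i.succ → f x = e i.succ) ∧
    (∀ x : D, a (Fin.last n) < x → f x = ⊥)

/-- A proximity Baer-Specker algebra `P` is exhibited as the de Vries power
`(D[A]^♭, ≺^♭)` of `D` by the de Vries algebra `A`: its elements are identified by `flat` with those
of `D[A]^♭`, the order is pointwise, the operations are those that the correspondence `toFlat`
carries over from `D[A]^*`, and `s ⊲ t` iff `s a ≺ t a` for all `a` in `D`. -/
structure DeVriesPowerPresentation (A : DeV.{w}) (P : PBSp.{u, w} D) where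
  /-- the element of `D[A]^*` that belongs to an element of `P` -/
  perp : P ≃ {f : D → A // IsBooleanPowerElem f}
  /-- the element of `D[A]^♭` that belongs to an element of `P` -/
  flat : P ≃ {f : D → A // IsFlatPowerElem f}
  flat_eq : ∀ s : P, (flat s : D → A) = toFlat (perp s : D → A)
  perp_add : ∀ s t : P, (perp (s + t) : D → A) = booleanPowerAdd (perp s) (perp t)
  perp_mul : ∀ s t : P, (perp (s * t) : D → A) = booleanPowerMul (perp s) (perp t)
  perp_smul : ∀ (b : D) (s : P), (perp (b • s) : D → A) = booleanPowerSMul b (perp s)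
  le_iff : ∀ s t : P, s ≤ t ↔ ∀ a : D, (flat s : D → A) a ≤ (flat t : D → A) a
  prox_iff : ∀ s t : P, P.prox s t ↔ ∀ a : D, A.prox ((flat s : D → A) a) ((flat t : D → A) a)

/-- The assignment `obj`, `map` is the de Vries power functor: it sends a de Vries algebra `(A, ≺)`
to `(D[A]^♭, ≺^♭)` and a de Vries morphism `σ` to `f ↦ σ ∘ f`. -/
structure DeVriesPowerFunctorPresentation (obj : DeV.{w} → PBSp.{u, w} D)
    (map : ∀ {A B : DeV.{w}}, DeV.Hom A B → PBSp.Hom (obj A) (obj B)) where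
  /-- the identification of `obj A` with the de Vries power of `D` by `A` -/
  power : ∀ A : DeV.{w}, DeVriesPowerPresentation A (obj A)
  flat_map : ∀ {A B : DeV.{w}} (σ : DeV.Hom A B) (s : obj A),
    ((power B).flat (map σ s) : D → B) = fun a => σ (((power A).flat s : D → A) a)

end Powers

/-! ## Idempotents -/

section Idempotents

variable {D : Type u} [CommRing D] [LinearOrder D]

/-- A de Vries algebra `A` is exhibited as the boolean algebra `Id(S)` of idempotents of `S`
(in which `e ≤ f` iff `e * f = e`) with the restriction of the proximity of `S`. -/
structure IdempotentsPresentation (S : PBSp.{u, w} D) (A : DeV.{w}) where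
  /-- the idempotent that belongs to an element of `A` -/
  idem : A ≃ {e : S // IsIdempotentElem e}
  le_iff : ∀ x y : A, x ≤ y ↔ (idem x : S) * (idem y : S) = idem x
  prox_iff : ∀ x y : A, A.prox x y ↔ S.prox (idem x) (idem y)

/-- The assignment `obj`, `map` is the idempotents functor: it sends `(S, ⊲)` to `Id(S)` with the
restriction of `⊲` and a proximity morphism `α : S → T` to its restriction `Id(S) → Id(T)`. -/
structure IdempotentsFunctorPresentation (obj : PBSp.{u, w} D → DeV.{w})
    (map : ∀ {S T : PBSp.{u, w} D}, PBSp.Hom S T → DeV.Hom (obj S) (obj T)) where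
  /-- the identification of `obj S` with `Id(S)` -/
  idems : ∀ S : PBSp.{u, w} D, IdempotentsPresentation S (obj S)
  idem_map : ∀ {S T : PBSp.{u, w} D} (α : PBSp.Hom S T) (x : obj S),
    ((idems T).idem (map α x) : T) = α ((idems S).idem x : S)

end Idempotents

/-!
The proof rests on one notion: a *function representation* of a lattice-ordered `D`-algebra `S`
over a boolean algebra `A`. It consists of a set `X`, an embedding of `A` as a field of sets in
`X`, and an isomorphism of `S` with the algebra of all functions `X → D` that are simple with
respect to this field, ordered pointwise. Given such a representation, an element `s` of `S` has
for each `p ⊆ D` an element `[s ∈ p]` of `A`; the functions `a ↦ [s = a]` and `a ↦ [a ≤ s]`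
(called `perp s` and `flat s`) are the elements of `D[A]^*` and `D[A]^♭` that belong to `s`. All
identities between infinite joins in boolean powers are thereby checked at the points of `X`. If
`S` and `A` carry proximities, the representation is required to satisfy `s ⊲ t ↔ ∀ a, [a ≤ s] ≺
[a ≤ t]`; then it exhibits `S` as the de Vries power of `D` by `A`.

Such representations exist in two situations.

* For a proximity Baer-Specker algebra `S`, take the idempotents of `S` for `A` and the algebra
  homomorphisms `S → D` for `X`. They separate points because a Specker algebra is locally a
  scalar (`IsSpeckerAlgebra.exists_isIdempotentElem_mul_eq_smul`), and they determine the order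
  (`IsFAlgebra.nonneg_iff_forall_algHom`). The proximity of `S` is determined by its restriction
  to idempotents since each `[a ≤ s]` is obtained from `s` by lattice operations and scalars
  (`FunctionRepresentation.smul_ind_flat`) and `s` is a positive combination of these idempotents
  and a constant (`IsProximity.of_ind_flat`). Completeness of `A` is the Baer condition.
* For a de Vries algebra `A`, take the prime ideals of `A` for `X` and let `S` be the algebra of
  simple functions (`DeV.power`).

If `S` and `T` are represented over `A` and `B`, then proximity morphisms `f : S → T` correspond
bijectively to de Vries morphisms `σ : A → B` through `[a ≤ f s] = σ [a ≤ s]`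
(`ProximityRepresentation.ofDeVHom`, `ProximityRepresentation.toDeVHom`), and least upper bounds
of `{g (f s) : s ⊲ t}` correspond to the joins `⋁ {τ (σ a) : a ≺ b}`
(`ProximityRepresentation.isComp_iff`). The category of de Vries algebras is verified directly,
the category of proximity Baer-Specker algebras is obtained from it by transport, the functor `Id`
is then fully faithful, and the unit and the counit of the equivalence arise from identity maps by
comparing two representations.
-/

/-! ### Simple functions over a field of sets -/

section SimpleFunctions

variable {D : Type u} {A : Type w} [BooleanAlgebra A] {X : Type*}

/-- A function `f : X → D` is simple with respect to the field of sets `φ A` if it takes finitely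
many values and each of its fibres belongs to `φ A`. -/
structure IsSimple (φ : BoundedLatticeHom A (Set X)) (f : X → D) : Prop where
  finite_range : (Set.range f).Finite
  fiber : ∀ a : D, ∃ x : A, φ x = f ⁻¹' {a}

variable {φ : BoundedLatticeHom A (Set X)}

theorem exists_eq_biUnion {ι : Type*} {I : Set ι} (hI : I.Finite) {p : ι → Set X}
    (hp : ∀ i ∈ I, ∃ a : A, φ a = p i) : ∃ a : A, φ a = ⋃ i ∈ I, p i := by
  induction I, hI using Set.Finite.induction_on with
  | empty => exact ⟨⊥, by simp⟩
  | insert _ _ ih =>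
    obtain ⟨a, ha⟩ := ih fun i hi => hp i (Set.mem_insert_of_mem _ hi)
    obtain ⟨b, hb⟩ := hp _ (Set.mem_insert _ _)
    exact ⟨b ⊔ a, by rw [map_sup, ha, hb, Set.biUnion_insert]; rfl⟩

theorem IsSimple.preimage {f : X → D} (hf : IsSimple φ f) (p : Set D) :
    ∃ a : A, φ a = f ⁻¹' p := by
  obtain ⟨a, ha⟩ := exists_eq_biUnion (φ := φ) (hf.finite_range.inter_of_left p)
    (p := fun d => f ⁻¹' {d}) fun d _ => hf.fiber d
  exact ⟨a, by rw [ha]; ext x; simp⟩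

theorem IsSimple.map₂ {f g : X → D} (hf : IsSimple φ f) (hg : IsSimple φ g) (F : D → D → D) :
    IsSimple φ fun x => F (f x) (g x) := by
  refine ⟨(hf.finite_range.image2 F hg.finite_range).subset ?_, fun a => ?_⟩
  · rintro _ ⟨x, rfl⟩
    exact ⟨_, ⟨x, rfl⟩, _, ⟨x, rfl⟩, rfl⟩
  · obtain ⟨c, hc⟩ := exists_eq_biUnion (φ := φ) hf.finite_range
      (p := fun d => f ⁻¹' {d} ∩ g ⁻¹' {e | F d e = a}) fun d _ => by
        obtain ⟨a, ha⟩ := hf.fiber d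
        obtain ⟨b, hb⟩ := hg.preimage {e | F d e = _}
        exact ⟨a ⊓ b, by rw [map_inf, ha, hb]; rfl⟩
    refine ⟨c, hc.trans ?_⟩
    ext x
    simp only [Set.mem_iUnion, Set.mem_range, Set.mem_inter_iff, Set.mem_preimage,
      Set.mem_singleton_iff, Set.mem_ofPred_eq, exists_prop]
    exact ⟨fun ⟨_, _, h, h'⟩ => h ▸ h', fun h => ⟨f x, ⟨x, rfl⟩, rfl, h⟩⟩

theorem isSimple_const (a : D) : IsSimple φ fun _ => a := by
  classical
  refine ⟨Set.finite_range_const, fun b => ?_⟩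
  by_cases h : a = b
  · exact ⟨⊤, by simp [h]⟩
  · exact ⟨⊥, by simp [h]⟩

theorem isSimple_ite (a : A) (b c : D) [DecidablePred (· ∈ φ a)] :
    IsSimple φ fun x => if x ∈ φ a then b else c := by
  classical
  refine ⟨(Set.toFinite {b, c}).subset ?_, fun d => ?_⟩
  · rintro _ ⟨x, rfl⟩
    dsimp only
    split_ifs <;> simp
  · refine ⟨(if b = d then a else ⊥) ⊔ (if c = d then aᶜ else ⊥), ?_⟩
    ext x
    by_cases hb : b = d <;> by_cases hc : c = d <;> by_cases hx : x ∈ φ a <;> simp_all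

end SimpleFunctions

/-! ### Algebras represented by simple functions -/

/-- A representation of a lattice-ordered `D`-algebra `S` as the algebra of all functions `X → D`
that are simple with respect to a field of sets isomorphic to `A`. -/
structure FunctionRepresentation (D : Type u) [CommRing D] [LinearOrder D] (S : Type w) [CommRing S]
    [Algebra D S] [Lattice S] (A : Type w) [BooleanAlgebra A] where
  /-- the underlying set of points -/
  X : Type w
  /-- the embedding of the boolean algebra as a field of sets -/
  φ : BoundedLatticeHom A (Set X)
  φ_injective : Function.Injective φ
  /-- the function that represents an element of the algebra -/
  ev : S →ₐ[D] X → D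
  isSimple : ∀ s : S, IsSimple φ (ev s)
  exists_ev_eq : ∀ f : X → D, IsSimple φ f → ∃ s : S, ev s = f
  le_iff' : ∀ s t : S, s ≤ t ↔ ∀ x : X, ev s x ≤ ev t x

namespace FunctionRepresentation

variable {D : Type u} [CommRing D] [LinearOrder D]
  {S : Type w} [CommRing S] [Algebra D S] [Lattice S] {A : Type w} [BooleanAlgebra A]
  (R : FunctionRepresentation D S A)

theorem le_iff {s t : S} : s ≤ t ↔ ∀ x : R.X, R.ev s x ≤ R.ev t x := R.le_iff' s t

theorem ext_ev {s t : S} (h : ∀ x : R.X, R.ev s x = R.ev t x) : s = t :=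
  le_antisymm (R.le_iff.2 fun x => (h x).le) (R.le_iff.2 fun x => (h x).ge)

theorem φ_le_iff {a b : A} : a ≤ b ↔ ∀ x ∈ R.φ a, x ∈ R.φ b := by
  rw [← inf_eq_left, ← R.φ_injective.eq_iff, map_inf]
  exact Set.inter_eq_left

theorem φ_ext {a b : A} (h : ∀ x, x ∈ R.φ a ↔ x ∈ R.φ b) : a = b :=
  R.φ_injective (Set.ext h)

@[simp] theorem mem_φ_inf {a b : A} {x : R.X} : x ∈ R.φ (a ⊓ b) ↔ x ∈ R.φ a ∧ x ∈ R.φ b := by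
  rw [map_inf]; rfl

@[simp] theorem mem_φ_compl {a : A} {x : R.X} : x ∈ R.φ aᶜ ↔ x ∉ R.φ a := by
  rw [map_compl']; rfl

@[simp] theorem mem_φ_top {x : R.X} : x ∈ R.φ ⊤ := by
  rw [map_top]; trivial

@[simp] theorem not_mem_φ_bot {x : R.X} : x ∉ R.φ ⊥ := by
  rw [map_bot]; exact id

@[simp] theorem ev_algebraMap (a : D) (x : R.X) : R.ev (algebraMap D S a) x = a := by
  rw [AlgHom.commutes]; rfl

@[simp] theorem ev_smul (a : D) (s : S) (x : R.X) : R.ev (a • s) x = a * R.ev s x := by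
  rw [map_smul]; rfl

/-- The element `[s ∈ p]` of the boolean algebra at which the function that represents `s` takes
values in `p`. -/
noncomputable def lev (s : S) (p : Set D) : A := ((R.isSimple s).preimage p).choose

@[simp] theorem mem_φ_lev {s : S} {p : Set D} {x : R.X} : x ∈ R.φ (R.lev s p) ↔ R.ev s x ∈ p := by
  rw [lev, ((R.isSimple s).preimage p).choose_spec]; rfl

theorem lev_congr {s t : S} {p q : Set D} (h : ∀ x, R.ev s x ∈ p ↔ R.ev t x ∈ q) :
    R.lev s p = R.lev t q :=
  R.φ_ext fun x => by simpa using h x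

/-- The decreasing function `a ↦ [a ≤ s]`. -/
noncomputable def flat (s : S) (a : D) : A := R.lev s (Set.Ici a)

@[simp] theorem mem_φ_flat {s : S} {a : D} {x : R.X} : x ∈ R.φ (R.flat s a) ↔ a ≤ R.ev s x :=
  R.mem_φ_lev

theorem le_iff_flat {s t : S} : s ≤ t ↔ ∀ a : D, R.flat s a ≤ R.flat t a := by
  simp only [R.le_iff, R.φ_le_iff, mem_φ_flat]
  exact ⟨fun h a x hx => hx.trans (h x), fun h x => h _ x le_rfl⟩

theorem flat_injective : Function.Injective R.flat := fun _ _ h =>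
  le_antisymm (R.le_iff_flat.2 fun a => (congrFun h a).le)
    (R.le_iff_flat.2 fun a => (congrFun h a).ge)

theorem flat_mono {s t : S} (h : s ≤ t) (a : D) : R.flat s a ≤ R.flat t a := R.le_iff_flat.1 h a

theorem flat_antitone (s : S) : Antitone (R.flat s) := fun _ _ h =>
  R.φ_le_iff.2 fun x hx => by
    rw [mem_φ_flat] at *
    exact h.trans hx

/-- The finite set of values of the function that represents `s`. -/
noncomputable def vals (s : S) : Finset D := (R.isSimple s).finite_range.toFinset

theorem ev_mem_vals (s : S) (x : R.X) : R.ev s x ∈ R.vals s := by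
  simp [vals]

theorem exists_of_mem_vals {s : S} {a : D} (h : a ∈ R.vals s) : ∃ x, R.ev s x = a := by
  simpa [vals] using h

/-- The element represented by the simple function `f`. -/
noncomputable def ofFun (f : R.X → D) (hf : IsSimple R.φ f) : S := (R.exists_ev_eq f hf).choose

@[simp] theorem ev_ofFun (f : R.X → D) (hf : IsSimple R.φ f) : R.ev (R.ofFun f hf) = f :=
  (R.exists_ev_eq f hf).choose_spec

@[simp] theorem ev_inf (s t : S) (x : R.X) : R.ev (s ⊓ t) x = min (R.ev s x) (R.ev t x) := by
  have h := R.ev_ofFun _ ((R.isSimple s).map₂ (R.isSimple t) min)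
  set r := R.ofFun _ ((R.isSimple s).map₂ (R.isSimple t) min)
  have : s ⊓ t = r := le_antisymm
    (R.le_iff.2 fun x => by
      rw [h]; exact le_min (R.le_iff.1 inf_le_left x) (R.le_iff.1 inf_le_right x))
    (le_inf (R.le_iff.2 fun x => by rw [h]; exact min_le_left _ _)
      (R.le_iff.2 fun x => by rw [h]; exact min_le_right _ _))
  rw [this, h]

@[simp] theorem ev_sup (s t : S) (x : R.X) : R.ev (s ⊔ t) x = max (R.ev s x) (R.ev t x) := by
  have h := R.ev_ofFun _ ((R.isSimple s).map₂ (R.isSimple t) max)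
  set r := R.ofFun _ ((R.isSimple s).map₂ (R.isSimple t) max)
  have : s ⊔ t = r := le_antisymm
    (sup_le (R.le_iff.2 fun x => by rw [h]; exact le_max_left _ _)
      (R.le_iff.2 fun x => by rw [h]; exact le_max_right _ _))
    (R.le_iff.2 fun x => by
      rw [h]; exact max_le (R.le_iff.1 le_sup_left x) (R.le_iff.1 le_sup_right x))
  rw [this, h]

open Classical in
/-- The idempotent that corresponds to an element of the boolean algebra. -/
noncomputable def ind (a : A) : S := R.ofFun _ (isSimple_ite a 1 0)

open Classical in
theorem ev_ind (a : A) (x : R.X) : R.ev (R.ind a) x = if x ∈ R.φ a then 1 else 0 := by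
  rw [ind, ev_ofFun]

open Classical in
/-- The step function `a ↦ ⊤` for `a ≤ m`, `a ↦ x` for `m < a ≤ n` and `a ↦ ⊥` for `n < a`, as an
element of the algebra. -/
noncomputable def step (m n : D) (x : A) : S := R.ofFun _ (isSimple_ite x n m)

open Classical in
theorem ev_step (m n : D) (a : A) (x : R.X) :
    R.ev (R.step m n a) x = if x ∈ R.φ a then n else m := by
  rw [step, ev_ofFun]

theorem flat_step {m n a : D} (hmn : m ≤ n) (x : A) :
    R.flat (R.step m n x) a = if a ≤ m then ⊤ else if a ≤ n then x else ⊥ := by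
  refine R.φ_ext fun y => ?_
  rw [mem_φ_flat, ev_step]
  by_cases h : y ∈ R.φ x <;> by_cases h₁ : a ≤ m <;> by_cases h₂ : a ≤ n <;> simp [h, h₁, h₂]
  exact h₂ (h₁.trans hmn)

theorem exists_flat_eq_top (s : S) : ∃ m : D, R.flat s m = ⊤ := by
  classical
  obtain ⟨m, hm⟩ := (R.vals s).bddBelow
  refine ⟨m, R.φ_ext fun x => ?_⟩
  simpa using hm (R.ev_mem_vals s x)

/-- The supremum of the step functions with value `c i` on `(m, a i]`. -/
theorem exists_flat_eq_sup {ι : Type*} (I : Finset ι) (m : D) (a : ι → D) (c : ι → A) :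
    ∃ s : S, ∀ b : D, R.flat s b = if b ≤ m then ⊤ else (I.filter fun i => b ≤ a i).sup c := by
  classical
  induction I using Finset.induction_on with
  | empty =>
    refine ⟨algebraMap D S m, fun b => R.φ_ext fun x => ?_⟩
    by_cases h : b ≤ m <;> simp [h]
  | insert i I _ ih =>
    obtain ⟨s, hs⟩ := ih
    refine ⟨s ⊔ R.step m (max m (a i)) (c i), fun b => R.φ_ext fun x => ?_⟩
    rw [mem_φ_flat, ev_sup, le_max_iff, ← R.mem_φ_flat, ← R.mem_φ_flat, hs,
      R.flat_step (le_max_left _ _)]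
    by_cases hm : b ≤ m <;> by_cases ha : b ≤ a i <;>
      simp [hm, ha, Finset.filter_insert, or_comm]

theorem flat_algebraMap (a b : D) :
    R.flat (algebraMap D S a) b = if b ≤ a then ⊤ else ⊥ := by
  refine R.φ_ext fun x => ?_
  by_cases h : b ≤ a <;> simp [h]

theorem ind_compl (x : A) : R.ind xᶜ = 1 - R.ind x :=
  R.ext_ev fun z => by
    by_cases hx : z ∈ R.φ x <;> simp [ev_ind, hx]

theorem ind_mul (x y : A) : R.ind (x ⊓ y) = R.ind x * R.ind y :=
  R.ext_ev fun z => by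
    by_cases hx : z ∈ R.φ x <;> by_cases hy : z ∈ R.φ y <;> simp [ev_ind, hx, hy]

theorem ind_bot : R.ind ⊥ = 0 := R.ext_ev fun z => by simp [ev_ind]

theorem isIdempotentElem_ind (x : A) : IsIdempotentElem (R.ind x) := by
  rw [IsIdempotentElem, ← ind_mul, inf_idem]

variable [IsStrictOrderedRing D]

theorem flat_ind (x : A) (a : D) :
    R.flat (R.ind x) a = if a ≤ 0 then ⊤ else if a ≤ 1 then x else ⊥ := by
  refine R.φ_ext fun y => ?_
  rw [mem_φ_flat, ev_ind]
  by_cases h : y ∈ R.φ x <;> by_cases h₁ : a ≤ 0 <;> by_cases h₂ : a ≤ 1 <;> simp [h, h₁, h₂]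
  exact h₂ (h₁.trans zero_le_one)

theorem flat_ind_one (x : A) : R.flat (R.ind x) 1 = x := by
  simp [flat_ind]

theorem ind_injective : Function.Injective R.ind := fun x y h => by
  rw [← R.flat_ind_one x, h, flat_ind_one]

theorem ind_inf (x y : A) : R.ind (x ⊓ y) = R.ind x ⊓ R.ind y :=
  R.ext_ev fun z => by
    by_cases hx : z ∈ R.φ x <;> by_cases hy : z ∈ R.φ y <;> simp [ev_ind, hx, hy]

theorem ind_flat_one_of_isIdempotentElem {e : S} (he : IsIdempotentElem e) :
    R.ind (R.flat e 1) = e := R.ext_ev fun x => by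
  have : IsIdempotentElem (R.ev e x) := by
    rw [IsIdempotentElem, ← Pi.mul_apply, ← map_mul, he.eq]
  rcases IsIdempotentElem.iff_eq_zero_or_one.1 this with h | h <;> simp [ev_ind, h]

end FunctionRepresentation

/-! ### The boolean power and the de Vries power -/

namespace FunctionRepresentation

variable {D : Type u} [CommRing D] [LinearOrder D]
  {S : Type w} [CommRing S] [Algebra D S] [Lattice S] {A : Type w} [CompleteBooleanAlgebra A]
  (R : FunctionRepresentation D S A)

theorem φ_mono {a b : A} (h : a ≤ b) {x : R.X} (hx : x ∈ R.φ a) : x ∈ R.φ b :=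
  R.φ_le_iff.1 h x hx

/-- The function `a ↦ [s = a]`. -/
noncomputable def perp (s : S) (a : D) : A := R.lev s {a}

@[simp] theorem mem_φ_perp {s : S} {a : D} {x : R.X} : x ∈ R.φ (R.perp s a) ↔ R.ev s x = a :=
  R.mem_φ_lev

theorem perp_injective : Function.Injective R.perp := fun s t h =>
  R.ext_ev fun x => by
    rw [eq_comm, ← mem_φ_perp, ← h, mem_φ_perp]

theorem isBooleanPowerElem_perp (s : S) : IsBooleanPowerElem (R.perp s) where
  finite_range := by
    refine (((R.vals s).finite_toSet.image (R.perp s)).insert ⊥).subset ?_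
    rintro _ ⟨a, rfl⟩
    by_cases ha : a ∈ R.vals s
    · exact Or.inr ⟨a, ha, rfl⟩
    · refine Or.inl (R.φ_ext fun x => ?_)
      simp only [mem_φ_perp, not_mem_φ_bot, iff_false]
      rintro rfl
      exact ha (R.ev_mem_vals s x)
  inf_eq_bot := fun {a b} hab => R.φ_ext fun x => by
    simp only [mem_φ_inf, mem_φ_perp, not_mem_φ_bot, iff_false, not_and]
    rintro rfl
    exact hab
  iSup_eq_top := top_le_iff.1 (R.φ_le_iff.2 fun x _ =>
    R.φ_mono (le_iSup (R.perp s) (R.ev s x)) (by simp))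

theorem exists_perp_eq {f : D → A} (hf : IsBooleanPowerElem f) : ∃ s : S, R.perp s = f := by
  -- the values other than `⊥` are pairwise disjoint, so `f` takes each of them only once
  have hfin : {a | f a ≠ ⊥}.Finite := by
    refine Set.Finite.of_finite_image (f := f) (hf.finite_range.subset (Set.image_subset_range _ _))
      fun a ha b _ hab => ?_
    by_contra hne
    exact ha (by rw [← hf.inf_eq_bot hne, ← hab, inf_idem])
  have hex : ∀ x : R.X, ∃ a, x ∈ R.φ (f a) := by
    have hsup : hfin.toFinset.sup f = ⊤ := by
      rw [← top_le_iff, ← hf.iSup_eq_top]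
      refine iSup_le fun a => ?_
      by_cases ha : f a = ⊥
      · simp [ha]
      · exact Finset.le_sup (by simpa using ha)
    intro x
    by_contra! hx
    have : x ∉ R.φ (hfin.toFinset.sup f) := by simp [hx]
    exact this (by rw [hsup]; exact R.mem_φ_top)
  choose g hg using hex
  have huniq : ∀ x a, x ∈ R.φ (f a) ↔ g x = a := fun x a => by
    refine ⟨fun h => ?_, fun h => h ▸ hg x⟩
    by_contra hne
    exact R.not_mem_φ_bot (x := x) (by
      rw [← hf.inf_eq_bot hne, mem_φ_inf]; exact ⟨hg x, h⟩)
  refine ⟨R.ofFun g ⟨hfin.subset ?_, fun a => ⟨f a, Set.ext fun x => huniq x a⟩⟩, ?_⟩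
  · rintro _ ⟨x, rfl⟩ h
    exact R.not_mem_φ_bot (x := x) (by rw [← h]; exact hg x)
  · funext a
    refine R.φ_ext fun x => ?_
    simp [huniq]

theorem flat_eq_toFlat (s : S) : R.flat s = toFlat (R.perp s) := by
  funext a
  refine le_antisymm (R.φ_le_iff.2 fun x hx => ?_)
    (iSup₂_le fun b hb => R.φ_le_iff.2 fun x hx => ?_)
  · exact R.φ_mono (le_iSup₂_of_le (R.ev s x) (R.mem_φ_flat.1 hx) le_rfl) (R.mem_φ_perp.2 rfl)
  · rw [mem_φ_perp] at hx
    rwa [mem_φ_flat, hx]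

theorem perp_add (s t : S) : R.perp (s + t) = booleanPowerAdd (R.perp s) (R.perp t) := by
  funext a
  refine le_antisymm (R.φ_le_iff.2 fun x hx => ?_) (iSup₂_le fun b c => iSup_le fun h =>
    R.φ_le_iff.2 fun x hx => ?_)
  · refine R.φ_mono (le_iSup₂_of_le (R.ev s x) (R.ev t x) (le_iSup_of_le ?_ le_rfl)) ?_
    · simpa using hx
    · simp
  · simp_all

theorem perp_mul (s t : S) : R.perp (s * t) = booleanPowerMul (R.perp s) (R.perp t) := by
  funext a
  refine le_antisymm (R.φ_le_iff.2 fun x hx => ?_) (iSup₂_le fun b c => iSup_le fun h =>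
    R.φ_le_iff.2 fun x hx => ?_)
  · refine R.φ_mono (le_iSup₂_of_le (R.ev s x) (R.ev t x) (le_iSup_of_le ?_ le_rfl)) ?_
    · simpa using hx
    · simp
  · simp_all

theorem perp_smul (b : D) (s : S) : R.perp (b • s) = booleanPowerSMul b (R.perp s) := by
  funext a
  refine le_antisymm (R.φ_le_iff.2 fun x hx => ?_) (iSup₂_le fun c h => R.φ_le_iff.2 fun x hx => ?_)
  · refine R.φ_mono (le_iSup₂_of_le (R.ev s x) ?_ le_rfl) ?_
    · simpa using hx
    · simp
  · simp_all

theorem isFlatPowerElem_flat (s : S) : IsFlatPowerElem (R.flat s) := by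
  classical
  -- `0` is only added to have a nonempty set of jumps when there are no points
  set V := insert 0 (R.vals s)
  obtain ⟨n, hn⟩ : ∃ n, V.card = n + 1 :=
    Nat.exists_eq_succ_of_ne_zero (Finset.card_ne_zero.2 (Finset.insert_nonempty _ _))
  set a := V.orderEmbOfFin hn
  have hrange : ∀ x, ∃ i, R.ev s x = a i := fun x => by
    have : R.ev s x ∈ Set.range a := by
      rw [Finset.range_orderEmbOfFin]
      exact Finset.mem_insert_of_mem (R.ev_mem_vals s x)
    exact this.imp fun _ h => h.symm
  refine ⟨n, fun i => R.flat s (a i), a, ?_, fun i j h => R.flat_antitone s (a.monotone h),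
    a.strictMono, fun x hx => ?_, fun i x h₁ h₂ => ?_, fun x hx => ?_⟩
  · refine R.φ_ext fun x => ?_
    obtain ⟨i, hi⟩ := hrange x
    simp [hi]
  · refine R.φ_ext fun y => ?_
    obtain ⟨i, hi⟩ := hrange y
    simpa [hi] using hx.trans (a.monotone (Fin.zero_le i))
  · refine R.φ_ext fun y => ?_
    obtain ⟨j, hj⟩ := hrange y
    simp only [mem_φ_flat, hj]
    refine ⟨fun h => ?_, fun h => h₂.trans h⟩
    have := a.lt_iff_lt.1 (h₁.trans_le h)
    exact a.monotone (Fin.castSucc_lt_iff_succ_le.1 this)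
  · refine R.φ_ext fun y => ?_
    obtain ⟨j, hj⟩ := hrange y
    simpa [hj] using (a.monotone (Fin.le_last j)).trans_lt hx

theorem exists_flat_eq {f : D → A} (hf : IsFlatPowerElem f) : ∃ s : S, R.flat s = f := by
  obtain ⟨n, e, a, h0, he, ha, htop, hmid, hbot⟩ := hf
  obtain ⟨s, hs⟩ := R.exists_flat_eq_sup Finset.univ (a 0) a e
  refine ⟨s, funext fun b => ?_⟩
  rw [hs]
  split_ifs with hb
  · exact (htop b hb).symm
  by_cases hl : a (Fin.last n) < b
  · rw [hbot b hl, Finset.filter_false_of_mem, Finset.sup_empty]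
    exact fun i _ => not_le.2 ((ha.monotone (Fin.le_last i)).trans_lt hl)
  · -- the first jump that is not below `b`
    have hex : ∃ i, b ≤ a i := ⟨_, not_lt.1 hl⟩
    obtain ⟨i, hi, hmin⟩ := WellFounded.has_min (r := (· < ·)) wellFounded_lt {i | b ≤ a i} hex
    have hi' : b ≤ a i := hi
    obtain ⟨j, rfl⟩ : ∃ j : Fin n, i = j.succ := Fin.exists_succ_eq_of_ne_zero (by
      rintro rfl; exact hb hi) |>.imp fun _ h => h.symm
    have hj : a j.castSucc < b := not_le.1 fun h => hmin _ h (Fin.castSucc_lt_succ)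
    rw [hmid j b hj hi']
    refine le_antisymm (Finset.sup_le fun k hk => he ?_) (Finset.le_sup (by simpa using hi'))
    exact not_lt.1 fun h => hmin k (by simpa using hk) h

end FunctionRepresentation

/-- A function representation over a de Vries algebra for which the proximity of the
algebra is the pointwise proximity of the functions `FunctionRepresentation.flat`. -/
structure ProximityRepresentation {D : Type u} [CommRing D] [LinearOrder D] (S : PBSp.{u, w} D)
    (A : DeV.{w}) extends FunctionRepresentation D S A where
  prox_iff' : ∀ s t : S, S.prox s t ↔ ∀ a : D, A.prox (toFunctionRepresentation.flat s a)
    (toFunctionRepresentation.flat t a)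

namespace ProximityRepresentation

variable {D : Type u} [CommRing D] [LinearOrder D] {S : PBSp.{u, w} D} {A : DeV.{w}}
  (R : ProximityRepresentation S A)

theorem prox_iff {s t : S} : S.prox s t ↔ ∀ a : D, A.prox (R.flat s a) (R.flat t a) :=
  R.prox_iff' s t

/-- A proximity representation over `A` exhibits the algebra as the de Vries power of `D` by `A`. -/
noncomputable def powerPresentation : DeVriesPowerPresentation A S where
  perp := Equiv.ofBijective (fun s => ⟨R.perp s, R.isBooleanPowerElem_perp s⟩)
    ⟨fun _ _ h => R.perp_injective (congrArg Subtype.val h),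
      fun f => (R.exists_perp_eq f.2).imp fun _ h => Subtype.ext h⟩
  flat := Equiv.ofBijective (fun s => ⟨R.flat s, R.isFlatPowerElem_flat s⟩)
    ⟨fun _ _ h => R.flat_injective (congrArg Subtype.val h),
      fun f => (R.exists_flat_eq f.2).imp fun _ h => Subtype.ext h⟩
  flat_eq := R.flat_eq_toFlat
  perp_add := R.perp_add
  perp_mul := R.perp_mul
  perp_smul := R.perp_smul
  le_iff := fun _ _ => R.le_iff_flat
  prox_iff := fun _ _ => R.prox_iff

end ProximityRepresentation

/-! ### De Vries proximities and de Vries morphisms -/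

namespace IsDeVriesProximity

variable {B : Type w} [BooleanAlgebra B] {prox : B → B → Prop}

theorem bot_prox (h : IsDeVriesProximity prox) (a : B) : prox ⊥ a :=
  h.mono le_rfl (by simpa using h.compl h.top_prox) bot_le

theorem prox_top (h : IsDeVriesProximity prox) (a : B) : prox a ⊤ := h.mono le_top h.top_prox le_rfl

theorem inf (h : IsDeVriesProximity prox) {a b c d : B} (hab : prox a b) (hcd : prox c d) :
    prox (a ⊓ c) (b ⊓ d) :=
  h.inf_right (h.mono inf_le_left hab le_rfl) (h.mono inf_le_right hcd le_rfl)

theorem sup_left (h : IsDeVriesProximity prox) {a b c : B} (ha : prox a c) (hb : prox b c) :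
    prox (a ⊔ b) c := by
  simpa [compl_inf] using h.compl (h.inf_right (h.compl ha) (h.compl hb))

end IsDeVriesProximity

namespace DeV

theorem isDeVries (A : DeV.{w}) : IsDeVriesProximity A.prox := A.isDeVriesProximity

theorem sSup_prox (A : DeV.{w}) (b : A) : sSup {a : A | A.prox a b} = b := by
  refine le_antisymm (sSup_le fun a ha => A.isDeVries.le_of_prox ha) ?_
  by_contra hne
  obtain ⟨c, hc, hcp⟩ := A.isDeVries.exists_prox (a := b ⊓ (sSup {a : A | A.prox a b})ᶜ)
    (by rwa [ne_eq, ← sdiff_eq, sdiff_eq_bot_iff])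
  have hc₁ : c ≤ sSup {a : A | A.prox a b} :=
    le_sSup (A.isDeVries.mono le_rfl hcp inf_le_left)
  have hc₂ := (A.isDeVries.le_of_prox hcp).trans inf_le_right
  exact hc (le_bot_iff.1 ((le_inf hc₁ hc₂).trans_eq (inf_compl_self _)))

namespace Hom

variable {A B : DeV.{w}} (σ : Hom A B)

theorem monotone : Monotone σ.toFun := fun a b h => by
  rw [← inf_eq_left, ← σ.map_inf, inf_eq_left.2 h]

theorem map_top : σ ⊤ = ⊤ := by
  have h := B.isDeVries.le_of_prox (σ.map_prox A.isDeVries.top_prox)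
  rwa [compl_top, σ.map_bot, compl_bot, top_le_iff] at h

theorem le_compl (a : A) : σ a ≤ (σ aᶜ)ᶜ := by
  rw [le_compl_iff_disjoint_right, disjoint_iff, ← σ.map_inf, inf_compl_self, σ.map_bot]

theorem prox {a b : A} (h : A.prox a b) : B.prox (σ a) (σ b) :=
  B.isDeVries.mono (σ.le_compl a) (σ.map_prox h) le_rfl

end Hom

end DeV

/-! ### Proximity morphisms and de Vries morphisms -/

section Cuts

variable {D : Type u} [CommRing D] [LinearOrder D] [IsStrictOrderedRing D]

theorem Finset.exists_forall_mem_iff_le_of_isUpperSet (F : Finset D) {p : Set D}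
    (hp : IsUpperSet p) : ∃ b, ∀ v ∈ F, v ∈ p ↔ b ≤ v := by
  classical
  by_cases h : (F.filter (· ∈ p)).Nonempty
  · refine ⟨(F.filter (· ∈ p)).min' h, fun v hv => ⟨fun hvp => Finset.min'_le _ _ (by simp [*]),
      fun hle => hp hle (Finset.mem_filter.1 (Finset.min'_mem _ h)).2⟩⟩
  · obtain ⟨m, hm⟩ := F.bddAbove
    refine ⟨m + 1, fun v hv => ⟨fun hvp => (h ⟨v, by simp [*]⟩).elim, fun hle => ?_⟩⟩
    exact absurd (hle.trans (hm hv)) (by simp)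

theorem Finset.exists_lt_forall_mem_le_of_lt (F : Finset D) (a : D) :
    ∃ b < a, ∀ v ∈ F, v < a → v ≤ b := by
  classical
  refine ⟨(insert (a - 1) (F.filter (· < a))).max' (Finset.insert_nonempty _ _), ?_,
    fun v hv h => Finset.le_max' _ _ (by simp [*])⟩
  rw [Finset.max'_lt_iff]
  simp

end Cuts

theorem PBSp.Hom.map_algebraMap {D : Type u} [CommRing D] [LinearOrder D] {S T : PBSp.{u, w} D}
    (f : PBSp.Hom S T) (a : D) : f (algebraMap D S a) = algebraMap D T a := by
  simpa [f.map_zero] using f.map_add_algebraMap 0 a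

/-- For `b < a` sufficiently close to `a`, the idempotent `[a ≤ s]` is obtained from `s` by means of
lattice operations and scalars. -/
theorem FunctionRepresentation.smul_ind_flat {D : Type u} [CommRing D] [LinearOrder D]
    [IsStrictOrderedRing D] {S : Type w} [CommRing S] [Algebra D S] [Lattice S] {A : Type w}
    [BooleanAlgebra A] (R : FunctionRepresentation D S A) {s : S} {a b : D} (hba : b < a)
    (hb : ∀ v ∈ R.vals s, v < a → v ≤ b) :
    (a - b) • R.ind (R.flat s a) =
      ((s ⊓ algebraMap D S a) ⊔ algebraMap D S b) + algebraMap D S (-b) := R.ext_ev fun x => by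
  simp only [R.ev_smul, R.ev_ind, R.mem_φ_flat, map_add, Pi.add_apply, R.ev_sup, R.ev_inf,
    R.ev_algebraMap]
  by_cases h : a ≤ R.ev s x
  · simp [h, hba.le, sub_eq_add_neg]
  · simp [h, hb _ (R.ev_mem_vals s x) (not_le.1 h)]

namespace ProximityRepresentation

variable {D : Type u} [CommRing D] [LinearOrder D]
  {S T U : PBSp.{u, w} D} {A B C : DeV.{w}}
  (R : ProximityRepresentation S A) (Q : ProximityRepresentation T B)
  (P : ProximityRepresentation U C)

/-- The map `f` of algebras acts on the functions `flat s` as composition with `σ`. -/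
def Represents (f : S → T) (σ : A → B) : Prop :=
  ∀ (s : S) (a : D), Q.flat (f s) a = σ (R.flat s a)

variable {R Q P}

theorem Represents.comp {f : S → T} {σ : A → B} {g : T → U} {τ : B → C} (hf : Represents R Q f σ)
    (hg : Represents Q P g τ) : Represents R P (fun s => g (f s)) fun a => τ (σ a) :=
  fun s a => by rw [hg, hf]

theorem Represents.eq_left {f g : S → T} {σ : A → B} (hf : Represents R Q f σ)
    (hg : Represents R Q g σ) : f = g :=
  funext fun s => Q.flat_injective (funext fun a => by rw [hf, hg])

/-- If `f` corresponds to the monotone map `τ`, then the join of the `f s` with `s ⊲ t` exists, and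
it is obtained by composition with `b ↦ ⋁ {τ a : a ≺ b}`. -/
theorem Represents.isLUB {f : S → T} {τ σ : A → B} (hf : Represents R Q f τ) (hτ : Monotone τ)
    (hσ : ∀ b, σ b = sSup (τ '' {a | A.prox a b})) {t : S} {u : T}
    (hu : ∀ a, Q.flat u a = σ (R.flat t a)) : IsLUB (f '' {s | S.prox s t}) u := by
  refine ⟨?_, fun v hv => Q.le_iff_flat.2 fun a => ?_⟩
  · rintro _ ⟨s, hs, rfl⟩
    refine Q.le_iff_flat.2 fun a => ?_
    rw [hf, hu, hσ]
    exact le_sSup ⟨_, R.prox_iff.1 hs a, rfl⟩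
  · rw [hu, hσ]
    refine sSup_le ?_
    rintro _ ⟨x, hx, rfl⟩
    -- the step function with value `x` up to `a` is proximal to `t`
    obtain ⟨m, hm⟩ := R.exists_flat_eq_top t
    have hs : S.prox (R.step (min m a) a x) t := by
      refine R.prox_iff.2 fun b => ?_
      rw [R.flat_step (min_le_right _ _)]
      split_ifs with h₁ h₂
      · have : R.flat t b = ⊤ :=
          top_le_iff.1 (hm ▸ R.flat_antitone t (h₁.trans (min_le_left _ _)))
        rw [this]
        exact A.isDeVries.top_prox
      · exact A.isDeVries.mono le_rfl hx (R.flat_antitone t h₂)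
      · exact A.isDeVries.bot_prox _
    refine le_trans ?_ (Q.flat_mono (hv ⟨_, hs, rfl⟩) a)
    rw [hf]
    refine hτ ?_
    rw [R.flat_step (min_le_right _ _)]
    split_ifs with h₁ h₂
    · exact le_top
    · exact le_rfl
    · exact absurd le_rfl h₂

theorem exists_represents (R : ProximityRepresentation S A) (Q : ProximityRepresentation T B)
    (σ : DeV.Hom A B) : ∃ f : S → T, Represents R Q f σ := by
  have h : ∀ s, ∃ t, Q.flat t = fun a => σ (R.flat s a) := fun s => by
    refine Q.exists_flat_eq ?_
    obtain ⟨n, e, a, h0, he, ha, htop, hmid, hbot⟩ := R.isFlatPowerElem_flat s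
    refine ⟨n, fun i => σ (e i), a, ?_, fun i j hij => σ.monotone (he hij), ha, fun x hx => ?_,
      fun i x h₁ h₂ => ?_, fun x hx => ?_⟩
    · simp only [h0, σ.map_top]
    · simp only [htop x hx, σ.map_top]
    · simp only [hmid i x h₁ h₂]
    · simp only [hbot x hx, σ.map_bot]
  choose f hf using h
  exact ⟨f, fun s a => congrFun (hf s) a⟩

variable [IsStrictOrderedRing D]

theorem Represents.eq_right {f : S → T} {σ τ : A → B} (hσ : Represents R Q f σ)
    (hτ : Represents R Q f τ) : σ = τ :=
  funext fun x => by rw [← R.flat_ind_one x, ← hσ, ← hτ]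

/-- Only finitely many values matter, and among them every upper set is of the form
`{v | a ≤ v}`. -/
theorem Represents.lev {f : S → T} {σ : A → B} (hf : Represents R Q f σ) (s : S) {p : Set D}
    (hp : IsUpperSet p) : Q.lev (f s) p = σ (R.lev s p) := by
  classical
  obtain ⟨b, hb⟩ := (R.vals s ∪ Q.vals (f s)).exists_forall_mem_iff_le_of_isUpperSet hp
  have h₁ : R.lev s p = R.flat s b := R.lev_congr fun x =>
    hb _ (Finset.mem_union_left _ (R.ev_mem_vals s x))
  have h₂ : Q.lev (f s) p = Q.flat (f s) b := Q.lev_congr fun x =>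
    hb _ (Finset.mem_union_right _ (Q.ev_mem_vals (f s) x))
  rw [h₁, h₂, hf]

/-- The proximity morphism `f ↦ σ ∘ f` that belongs to a de Vries morphism `σ`. -/
noncomputable def ofDeVHom (R : ProximityRepresentation S A) (Q : ProximityRepresentation T B)
    (σ : DeV.Hom A B) : PBSp.Hom S T :=
  let f := (exists_represents R Q σ).choose
  have hf : Represents R Q f σ := (exists_represents R Q σ).choose_spec
  have hflat : ∀ {s t a b}, R.flat s a = R.flat t b → Q.flat (f s) a = Q.flat (f t) b :=
    fun h => by rw [hf, hf, h]
  have hconst : ∀ a : D, f (algebraMap D S a) = algebraMap D T a := fun a =>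
    Q.flat_injective (funext fun b => by
      rw [hf, R.flat_algebraMap, Q.flat_algebraMap]
      split_ifs
      exacts [σ.map_top, σ.map_bot])
  { toFun := f
    map_zero := by simpa using hconst 0
    map_inf := fun s t => Q.flat_injective (funext fun a => by
      have h₁ : R.flat (s ⊓ t) a = R.flat s a ⊓ R.flat t a := R.φ_ext fun x => by simp
      have h₂ : Q.flat (f s ⊓ f t) a = Q.flat (f s) a ⊓ Q.flat (f t) a := Q.φ_ext fun x => by simp
      rw [h₂, hf, h₁, σ.map_inf, hf, hf])
    map_prox := fun {s t} h => Q.prox_iff.2 fun a => by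
      have h₁ : Q.flat (-f (-s)) a = (σ (R.flat s a)ᶜ)ᶜ := by
        have : (R.flat s a)ᶜ = R.lev (-s) (Set.Ioi (-a)) := R.φ_ext fun x => by simp
        rw [this, ← hf.lev _ (isUpperSet_Ioi _)]
        exact Q.φ_ext fun x => by simp [le_neg]
      rw [h₁, hf]
      exact σ.map_prox (R.prox_iff.1 h a)
    map_isLUB := fun t => hf.isLUB σ.monotone σ.map_sSup (hf t)
    map_add_algebraMap := fun s a => Q.flat_injective (funext fun b => by
      have h₁ : R.flat (s + algebraMap D S a) b = R.flat s (b - a) :=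
        R.φ_ext fun x => by simp
      have h₂ : Q.flat (f s + algebraMap D T a) b = Q.flat (f s) (b - a) :=
        Q.φ_ext fun x => by simp
      rw [h₂, hf, h₁, hf])
    map_smul := fun a s ha => Q.flat_injective (funext fun b => by
      have h₁ : R.flat (a • s) b = R.lev s {c | b ≤ a * c} := R.φ_ext fun x => by simp
      have h₂ : Q.flat (a • f s) b = Q.lev (f s) {c | b ≤ a * c} := Q.φ_ext fun x => by simp
      rw [h₂, hf, h₁, hf.lev]
      exact fun c d hcd hc => le_trans hc (mul_le_mul_of_nonneg_left hcd ha))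
    map_sup_algebraMap := fun s a => Q.flat_injective (funext fun b => by
      have h₁ : R.flat (s ⊔ algebraMap D S a) b = if b ≤ a then ⊤ else R.flat s b :=
        R.φ_ext fun x => by by_cases h : b ≤ a <;> simp [h]
      have h₂ : Q.flat (f s ⊔ algebraMap D T a) b = if b ≤ a then ⊤ else Q.flat (f s) b :=
        Q.φ_ext fun x => by by_cases h : b ≤ a <;> simp [h]
      rw [h₂, hf, h₁]
      split_ifs
      exacts [σ.map_top, (hf s b).symm]) }

theorem represents_ofDeVHom (σ : DeV.Hom A B) : Represents R Q (ofDeVHom R Q σ) σ :=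
  (exists_represents R Q σ).choose_spec

section ToDeVHom

variable (f : PBSp.Hom S T)

/-- A proximity morphism is determined by its effect on idempotents: for `b < a` sufficiently close
to `a`, the idempotent `[a ≤ s]` satisfies `(a - b) [a ≤ s] = ((s ∧ a) ∨ b) - b`, and `f` commutes
with all operations on the right. -/
theorem map_ind_flat (s : S) (a : D) : f (R.ind (R.flat s a)) = Q.ind (Q.flat (f s) a) := by
  classical
  obtain ⟨b, hba, hb⟩ := (R.vals s ∪ Q.vals (f s)).exists_lt_forall_mem_le_of_lt a
  have h₁ := R.smul_ind_flat hba fun v hv => hb v (Finset.mem_union_left _ hv)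
  have h₂ := Q.smul_ind_flat hba fun v hv => hb v (Finset.mem_union_right _ hv)
  have h₃ : (a - b) • f (R.ind (R.flat s a)) = (a - b) • Q.ind (Q.flat (f s) a) := by
    rw [h₂, ← f.map_smul _ _ (sub_nonneg.2 hba.le), h₁, f.map_add_algebraMap, f.map_sup_algebraMap,
      f.map_inf, f.map_algebraMap]
  refine Q.ext_ev fun x => mul_left_cancel₀ (sub_pos.2 hba).ne' ?_
  rw [← Q.ev_smul, h₃, Q.ev_smul]

/-- The de Vries morphism that belongs to a proximity morphism. -/
noncomputable def toDeVHom (R : ProximityRepresentation S A) (Q : ProximityRepresentation T B)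
    (f : PBSp.Hom S T) : DeV.Hom A B :=
  let σ : A → B := fun x => Q.flat (f (R.ind x)) 1
  have hind : ∀ x, f (R.ind x) = Q.ind (σ x) := fun x => by
    rw [← map_ind_flat, R.flat_ind_one]
  have hf : Represents R Q f σ := fun s a => by
    rw [← Q.flat_ind_one (Q.flat (f s) a), ← map_ind_flat]
  have hinf : ∀ x y, σ (x ⊓ y) = σ x ⊓ σ y := fun x y => Q.ind_injective (by
    rw [← hind, R.ind_inf, f.map_inf, hind, hind, Q.ind_inf])
  have hbot : σ ⊥ = ⊥ := Q.ind_injective (by rw [← hind, R.ind_bot, f.map_zero, Q.ind_bot])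
  have hprox : ∀ {x y}, A.prox x y → S.prox (R.ind x) (R.ind y) := fun {x y} h =>
    R.prox_iff.2 fun a => by
      rw [R.flat_ind, R.flat_ind]
      split_ifs
      exacts [A.isDeVries.top_prox, h, A.isDeVries.bot_prox _]
  have hmono : Monotone σ := fun x y h => by rw [← inf_eq_left, ← hinf, inf_eq_left.2 h]
  { toFun := σ
    map_bot := hbot
    map_inf := hinf
    map_prox := fun {x y} h => by
      have h₁ : -f (-R.ind x) = Q.ind (σ xᶜ)ᶜ := by
        have : -R.ind x = R.ind xᶜ + algebraMap D S (-1) := by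
          rw [R.ind_compl, map_neg, map_one]; ring
        rw [this, f.map_add_algebraMap, hind, Q.ind_compl, map_neg, map_one]
        ring
      have h₂ := Q.prox_iff.1 (f.map_prox (hprox h)) 1
      rwa [h₁, hind, Q.flat_ind_one, Q.flat_ind_one] at h₂
    map_sSup := fun b => by
      refine le_antisymm ?_ (sSup_le ?_)
      · have hle : f (R.ind b) ≤ Q.ind (sSup (σ '' {a | A.prox a b})) := by
          refine (f.map_isLUB (R.ind b)).2 ?_
          rintro _ ⟨s, hs, rfl⟩
          refine Q.le_iff_flat.2 fun a => ?_
          have hsa := R.prox_iff.1 hs a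
          rw [hf, Q.flat_ind]
          rw [R.flat_ind] at hsa
          split_ifs at hsa ⊢
          · exact le_top
          · exact le_sSup ⟨_, hsa, rfl⟩
          · rw [le_bot_iff.1 (A.isDeVries.le_of_prox hsa), hbot]
        have := Q.flat_mono hle 1
        rwa [hind, Q.flat_ind_one, Q.flat_ind_one] at this
      · rintro _ ⟨a, ha, rfl⟩
        exact hmono (A.isDeVries.le_of_prox ha) }

theorem represents_toDeVHom : Represents R Q f (toDeVHom R Q f) := fun s a => by
  rw [← Q.flat_ind_one (Q.flat (f s) a), ← map_ind_flat]
  rfl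

theorem map_ind (x : A) : f (R.ind x) = Q.ind (toDeVHom R Q f x) := by
  rw [← R.flat_ind_one x, map_ind_flat, represents_toDeVHom]

end ToDeVHom

end ProximityRepresentation

/-! ### Specker algebras as algebras of simple functions -/

namespace IsSpeckerAlgebra

variable {D : Type u} [CommRing D] {S : Type w} [CommRing S] [Algebra D S]

/-- Locally, each element of a Specker algebra is a scalar: the elements `s` for which this holds
form a subalgebra that contains the idempotents. -/
theorem exists_isIdempotentElem_mul_eq_smul (hS : IsSpeckerAlgebra D S) (s : S) {x : S}
    (hx : x ≠ 0) : ∃ (h : S) (c : D), IsIdempotentElem h ∧ h * x ≠ 0 ∧ h * s = c • h := by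
  have hs : s ∈ Algebra.adjoin D {e : S | IsIdempotentElem e} := by
    rw [hS.adjoin_eq_top]; trivial
  induction hs using Algebra.adjoin_induction generalizing x with
  | mem e he =>
    by_cases hex : e * x = 0
    · refine ⟨1 - e, 0, IsIdempotentElem.one_sub he, ?_, ?_⟩
      · rwa [sub_mul, one_mul, hex, sub_zero]
      · rw [zero_smul, sub_mul, one_mul, he, sub_self]
    · exact ⟨e, 1, he, hex, by rw [one_smul, he]⟩
  | algebraMap a =>
    exact ⟨1, a, .one, by rwa [one_mul], by rw [one_mul, Algebra.algebraMap_eq_smul_one]⟩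
  | add s t _ _ ihs iht =>
    obtain ⟨h, c, hh, hhx, hc⟩ := ihs hx
    obtain ⟨k, d, hk, hkx, hd⟩ := iht hhx
    refine ⟨k * h, c + d, hk.mul hh, by rwa [mul_assoc], ?_⟩
    calc k * h * (s + t) = k * (h * s) + h * (k * t) := by ring
      _ = (c + d) • (k * h) := by
        rw [hc, hd, mul_smul_comm, mul_smul_comm, mul_comm h k, add_smul]
  | mul s t _ _ ihs iht =>
    obtain ⟨h, c, hh, hhx, hc⟩ := ihs hx
    obtain ⟨k, d, hk, hkx, hd⟩ := iht hhx
    refine ⟨k * h, c * d, hk.mul hh, by rwa [mul_assoc], ?_⟩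
    calc k * h * (s * t) = (h * s) * (k * t) := by ring
      _ = (c * d) • (k * h) := by
        rw [hc, hd, smul_mul_smul_comm, mul_comm h k]

variable [IsDomain D]

/-- The homomorphisms to `D` separate points. If `s ≠ 0`, then `h * s = c • h ≠ 0` for an idempotent
`h`, and a prime ideal that contains no nonzero multiple `a • h` has quotient `D`. -/
theorem exists_algHom_ne_zero (hS : IsSpeckerAlgebra D S) {s : S} (hs : s ≠ 0) :
    ∃ χ : S →ₐ[D] D, χ s ≠ 0 := by
  have := hS.torsionFree
  obtain ⟨h, c, hh, hhs, hc⟩ := hS.exists_isIdempotentElem_mul_eq_smul s hs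
  have hch : c • h ≠ 0 := hc ▸ hhs
  obtain ⟨hc0, hh0⟩ := smul_ne_zero_iff.1 hch
  let M : Submonoid S :=
    { carrier := {x | x = 1 ∨ ∃ a : D, a ≠ 0 ∧ x = a • h}
      one_mem' := Or.inl rfl
      mul_mem' := by
        rintro _ _ (rfl | ⟨a, ha, rfl⟩) (rfl | ⟨b, hb, rfl⟩)
        · exact Or.inl (mul_one 1)
        · exact Or.inr ⟨b, hb, one_mul _⟩
        · exact Or.inr ⟨a, ha, mul_one _⟩
        · exact Or.inr ⟨a * b, mul_ne_zero ha hb, by rw [smul_mul_smul_comm, hh]⟩ }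
  have h0 : (0 : S) ∉ M := by
    rintro (h0 | ⟨a, ha, h0⟩)
    · exact hh0 (by rw [← one_mul h, ← h0, zero_mul])
    · exact smul_ne_zero ha hh0 h0.symm
  obtain ⟨P, hP, -, hPM⟩ := Ideal.exists_le_prime_disjoint (⊥ : Ideal S) M
    (Set.disjoint_left.2 fun x hx hxM => h0 ((Ideal.mem_bot.1 hx) ▸ hxM))
  have hPM' : ∀ a : D, a ≠ 0 → a • h ∉ P := fun a ha hmem =>
    Set.disjoint_left.1 hPM hmem (Or.inr ⟨a, ha, rfl⟩)
  have hbij : Function.Bijective (algebraMap D (S ⧸ P)) := by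
    constructor
    · rw [injective_iff_map_eq_zero]
      intro a ha
      by_contra ha0
      refine hPM' a ha0 ?_
      rw [← Ideal.Quotient.mk_algebraMap, Ideal.Quotient.eq_zero_iff_mem] at ha
      rw [Algebra.smul_def]
      exact P.mul_mem_right h ha
    · have hrange : (⊤ : Subalgebra D S).map (Ideal.Quotient.mkₐ D P) ≤ ⊥ := by
        rw [← hS.adjoin_eq_top, AlgHom.map_adjoin, Algebra.adjoin_le_iff]
        rintro _ ⟨e, he, rfl⟩
        have : IsIdempotentElem (Ideal.Quotient.mkₐ D P e) := he.map _
        rcases IsIdempotentElem.iff_eq_zero_or_one.1 this with h | h <;> rw [h]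
        · exact zero_mem _
        · exact one_mem _
      intro y
      obtain ⟨x, rfl⟩ := Ideal.Quotient.mkₐ_surjective D P y
      exact Algebra.mem_bot.1 (hrange ⟨x, trivial, rfl⟩)
  let E : D ≃ₐ[D] S ⧸ P := AlgEquiv.ofBijective (Algebra.ofId D (S ⧸ P)) hbij
  refine ⟨(E.symm : S ⧸ P →ₐ[D] D).comp (Ideal.Quotient.mkₐ D P), fun h0 => ?_⟩
  have hsP : s ∈ P := by
    rw [← Ideal.Quotient.eq_zero_iff_mem]
    simpa using h0
  exact hPM' c hc0 (hc ▸ P.mul_mem_left h hsP)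

/-- The homomorphisms to `D` at which an idempotent takes the value `1`. -/
def spectralSet (D : Type u) [CommRing D] [IsDomain D] (S : Type w) [CommRing S] [Algebra D S] :
    BoundedLatticeHom {e : S // IsIdempotentElem e} (Set (S →ₐ[D] D)) where
  toFun e := {χ | χ e = 1}
  map_sup' e f := by
    ext χ
    have he : IsIdempotentElem (χ e) := e.2.map χ
    have hf : IsIdempotentElem (χ f) := f.2.map χ
    change χ ((e : S) + f - e * f) = 1 ↔ χ e = 1 ∨ χ f = 1
    rw [map_sub, map_add, map_mul]
    rcases IsIdempotentElem.iff_eq_zero_or_one.1 he with h | h <;>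
      rcases IsIdempotentElem.iff_eq_zero_or_one.1 hf with h' | h' <;> simp [h, h']
  map_inf' e f := by
    ext χ
    have he : IsIdempotentElem (χ e) := e.2.map χ
    have hf : IsIdempotentElem (χ f) := f.2.map χ
    change χ ((e : S) * f) = 1 ↔ χ e = 1 ∧ χ f = 1
    rw [map_mul]
    rcases IsIdempotentElem.iff_eq_zero_or_one.1 he with h | h <;>
      rcases IsIdempotentElem.iff_eq_zero_or_one.1 hf with h' | h' <;> simp [h, h']
  map_top' := by
    ext χ
    change χ 1 = 1 ↔ True
    simp
  map_bot' := by
    ext χ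
    change χ 0 = 1 ↔ False
    simp

theorem mem_spectralSet {e : {e : S // IsIdempotentElem e}} {χ : S →ₐ[D] D} :
    χ ∈ spectralSet D S e ↔ χ e = 1 := Iff.rfl

theorem ext_algHom (hS : IsSpeckerAlgebra D S) {s t : S} (h : ∀ χ : S →ₐ[D] D, χ s = χ t) :
    s = t := by
  by_contra hne
  obtain ⟨χ, hχ⟩ := hS.exists_algHom_ne_zero (sub_ne_zero.2 hne)
  exact hχ (by rw [map_sub, h, sub_self])

open Classical in
theorem algHom_apply_idempotent (χ : S →ₐ[D] D) (e : {e : S // IsIdempotentElem e}) :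
    χ e = if χ ∈ spectralSet D S e then 1 else 0 := by
  have : IsIdempotentElem (χ e) := e.2.map χ
  rw [mem_spectralSet]
  rcases IsIdempotentElem.iff_eq_zero_or_one.1 this with h | h <;> simp [h]

theorem spectralSet_injective (hS : IsSpeckerAlgebra D S) :
    Function.Injective (spectralSet D S) := fun e f h =>
  Subtype.ext (hS.ext_algHom fun χ => by
    rw [algHom_apply_idempotent, algHom_apply_idempotent, h])

/-- Evaluation at the homomorphisms to `D`. -/
def eval (D : Type u) [CommRing D] (S : Type w) [CommRing S] [Algebra D S] :
    S →ₐ[D] (S →ₐ[D] D) → D := AlgHom.pi fun χ => χ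

theorem isSimple_eval (hS : IsSpeckerAlgebra D S) (s : S) :
    IsSimple (spectralSet D S) (eval D S s) := by
  classical
  have hs : s ∈ Algebra.adjoin D {e : S | IsIdempotentElem e} := by
    rw [hS.adjoin_eq_top]; trivial
  induction hs using Algebra.adjoin_induction with
  | mem e he =>
    have : eval D S e = fun χ => if χ ∈ spectralSet D S ⟨e, he⟩ then 1 else 0 :=
      funext fun χ => algHom_apply_idempotent χ ⟨e, he⟩
    rw [this]
    exact isSimple_ite _ _ _
  | algebraMap a =>
    rw [AlgHom.commutes]
    exact isSimple_const a
  | add s t _ _ hs ht => rw [map_add]; exact hs.map₂ ht (· + ·)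
  | mul s t _ _ hs ht => rw [map_mul]; exact hs.map₂ ht (· * ·)

theorem exists_eval_eq {f : (S →ₐ[D] D) → D} (hf : IsSimple (spectralSet D S) f) :
    ∃ s : S, eval D S s = f := by
  classical
  choose e he using hf.fiber
  refine ⟨∑ a ∈ hf.finite_range.toFinset, a • (e a : S), funext fun χ => ?_⟩
  have : ∀ a, χ (a • (e a : S)) = if f χ = a then a else 0 := fun a => by
    have hmem : χ ∈ spectralSet D S (e a) ↔ f χ = a := by rw [he]; rfl
    rw [map_smul, algHom_apply_idempotent]
    by_cases h : f χ = a <;> simp [hmem, h]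
  change χ _ = _
  rw [map_sum, Finset.sum_congr rfl fun a _ => this a, Finset.sum_ite_eq, if_pos (by simp)]

end IsSpeckerAlgebra

namespace IsFAlgebra

variable {D : Type u} [CommRing D] [LinearOrder D] {S : Type w} [CommRing S] [Algebra D S]
  [Lattice S]

theorem isOrderedAddMonoid (hF : IsFAlgebra D S) : IsOrderedAddMonoid S where
  add_le_add_left _ _ h r := hF.add_le_add_right h r

theorem mul_self_nonneg (hF : IsFAlgebra D S) (s : S) : 0 ≤ s * s := by
  have := hF.isOrderedAddMonoid
  have h₁ : s⁻ * s⁺ ⊓ s⁻ = 0 :=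
    hF.mul_inf_eq_zero (posPart_inf_negPart_eq_zero s) (negPart_nonneg s)
  have h₂ : s⁺ * s⁻ ⊓ s⁻ * s⁺ = 0 :=
    hF.mul_inf_eq_zero (by rw [inf_comm, h₁]) (posPart_nonneg s)
  have h₃ : s⁺ * s⁻ = 0 := by rwa [mul_comm s⁻, inf_idem] at h₂
  have h₄ : s * s = s⁺ * s⁺ + s⁻ * s⁻ := by
    calc s * s = (s⁺ - s⁻) * (s⁺ - s⁻) := by rw [posPart_sub_negPart]
      _ = s⁺ * s⁺ + s⁻ * s⁻ - 2 * (s⁺ * s⁻) := by ring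
      _ = _ := by rw [h₃, mul_zero, sub_zero]
  rw [h₄]
  exact add_nonneg (hF.mul_nonneg (posPart_nonneg s) (posPart_nonneg s))
    (hF.mul_nonneg (negPart_nonneg s) (negPart_nonneg s))

theorem nonneg_of_isIdempotentElem (hF : IsFAlgebra D S) {e : S} (he : IsIdempotentElem e) :
    0 ≤ e := by
  rw [← he.eq]
  exact hF.mul_self_nonneg e

variable [IsDomain D] [IsOrderedAddMonoid D]

/-- The order of a Specker algebra is determined: if `0 ≤ s` and `e` is the idempotent at which `s`
takes the value `c < 0`, then `0 ≤ e * s = c • e ≤ 0`. -/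
theorem nonneg_iff_forall_algHom (hF : IsFAlgebra D S) (hS : IsSpeckerAlgebra D S) (s : S) :
    0 ≤ s ↔ ∀ χ : S →ₐ[D] D, 0 ≤ χ s := by
  classical
  have := hF.isOrderedAddMonoid
  choose e he using (hS.isSimple_eval s).fiber
  have hmem : ∀ a χ, χ ∈ IsSpeckerAlgebra.spectralSet D S (e a) ↔ χ s = a := fun a χ => by
    rw [he]; rfl
  have hχ : ∀ a (χ : S →ₐ[D] D), χ (e a) = if χ s = a then 1 else 0 := fun a χ => by
    rw [IsSpeckerAlgebra.algHom_apply_idempotent]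
    simp only [hmem]
  refine ⟨fun hs χ => ?_, fun hs => ?_⟩
  · by_contra! hneg
    have h₁ : (e (χ s) : S) * s = χ s • (e (χ s) : S) := hS.ext_algHom fun ψ => by
      rw [map_mul, map_smul, hχ]
      by_cases h : ψ s = χ s <;> simp [h]
    have h₂ : 0 ≤ (e (χ s) : S) := hF.nonneg_of_isIdempotentElem (e (χ s)).2
    have h₃ : 0 ≤ χ s • (e (χ s) : S) := h₁ ▸ hF.mul_nonneg h₂ hs
    have h₄ : 0 ≤ (-χ s) • (e (χ s) : S) := hF.smul_nonneg (neg_nonneg.2 hneg.le) h₂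
    rw [neg_smul, neg_nonneg] at h₄
    have h₅ := congrArg χ (le_antisymm h₄ h₃)
    rw [map_smul, hχ, if_pos rfl, map_zero, smul_eq_mul, mul_one] at h₅
    exact hneg.ne h₅
  · have hsum : s = ∑ a ∈ (hS.isSimple_eval s).finite_range.toFinset, a • (e a : S) :=
      hS.ext_algHom fun χ => by
        have : ∀ a, χ (a • (e a : S)) = if χ s = a then a else 0 := fun a => by
          rw [map_smul, hχ]
          by_cases h : χ s = a <;> simp [h]
        rw [map_sum, Finset.sum_congr rfl fun a _ => this a, Finset.sum_ite_eq, if_pos]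
        simpa using ⟨χ, rfl⟩
    rw [hsum]
    refine Finset.sum_nonneg fun a ha => hF.smul_nonneg ?_ (hF.nonneg_of_isIdempotentElem (e a).2)
    obtain ⟨χ, rfl⟩ := (Set.Finite.mem_toFinset _).1 ha
    exact hs χ

theorem le_iff_forall_algHom (hF : IsFAlgebra D S) (hS : IsSpeckerAlgebra D S) (s t : S) :
    s ≤ t ↔ ∀ χ : S →ₐ[D] D, χ s ≤ χ t := by
  have := hF.isOrderedAddMonoid
  rw [← sub_nonneg, hF.nonneg_iff_forall_algHom hS]
  simp

end IsFAlgebra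

/-- A Specker algebra is represented by simple functions on the set of its homomorphisms to `D`,
over the boolean algebra of its idempotents. -/
def spectralRepresentation {D : Type u} [CommRing D] [IsDomain D] [LinearOrder D]
    [IsOrderedAddMonoid D] {S : Type (max u v)} [CommRing S] [Algebra D S] [Lattice S]
    (hS : IsSpeckerAlgebra D S) (hF : IsFAlgebra D S) :
    FunctionRepresentation D S {e : S // IsIdempotentElem e} where
  X := S →ₐ[D] D
  φ := IsSpeckerAlgebra.spectralSet D S
  φ_injective := hS.spectralSet_injective
  ev := IsSpeckerAlgebra.eval D S
  isSimple := hS.isSimple_eval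
  exists_ev_eq _ := IsSpeckerAlgebra.exists_eval_eq
  le_iff' := hF.le_iff_forall_algHom hS

/-! ### The de Vries algebra of idempotents -/

section CompleteIdempotents

variable {S : Type w} [CommRing S]

/-- If the annihilator of the ideal generated by a set of idempotents is generated by the idempotent
`e`, then `1 - e` is the join of the set. -/
theorem IsBaerRing.exists_isLUB (hS : IsBaerRing S) (E : Set {e : S // IsIdempotentElem e}) :
    ∃ e, IsLUB E e := by
  obtain ⟨e, he, hann⟩ := hS (Ideal.span (Subtype.val '' E))
  have hmem : ∀ x : S, x ∈ Ideal.span {e} ↔ ∀ f ∈ E, x * f = 0 := fun x => by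
    rw [← hann, Ideal.span, Submodule.mem_annihilator_span]
    simp
  refine ⟨⟨1 - e, he.one_sub⟩, fun f hf => ?_, fun g hg => ?_⟩
  · have := (hmem e).1 (Ideal.mem_span_singleton_self e) f hf
    change (f : S) * (1 - e) = f
    rw [mul_sub, mul_one, mul_comm, this, sub_zero]
  · have hg' : 1 - (g : S) ∈ Ideal.span {e} := (hmem _).2 fun f hf => by
      have : (f : S) * g = f := hg hf
      rw [sub_mul, one_mul, mul_comm, this, sub_self]
    obtain ⟨r, hr⟩ := Ideal.mem_span_singleton'.1 hg'
    change (1 - e) * (g : S) = 1 - e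
    have : (1 - e) * (1 - g) = 0 := by
      rw [← hr, sub_mul, one_mul, mul_left_comm, he, sub_self]
    rw [mul_sub, mul_one, sub_eq_zero] at this
    exact this.symm

/-- The idempotents of a Baer ring form a complete boolean algebra. -/
@[reducible] noncomputable def IsBaerRing.completeBooleanAlgebra (hS : IsBaerRing S) :
    CompleteBooleanAlgebra {e : S // IsIdempotentElem e} :=
  { (inferInstance : BooleanAlgebra {e : S // IsIdempotentElem e}) with
    sSup := fun E => (hS.exists_isLUB E).choose
    isLUB_sSup := fun E => (hS.exists_isLUB E).choose_spec
    sInf := fun E => (hS.exists_isLUB (lowerBounds E)).choose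
    isGLB_sInf := fun E => isLUB_lowerBounds.1 (hS.exists_isLUB (lowerBounds E)).choose_spec }

end CompleteIdempotents

namespace IsProximity

variable {D : Type u} [CommRing D] [LinearOrder D]
  {S : Type w} [CommRing S] [Algebra D S] [Lattice S] {prox : S → S → Prop}

theorem inf (h : IsProximity D prox) {s t r u : S} (hst : prox s t) (hru : prox r u) :
    prox (s ⊓ r) (t ⊓ u) :=
  h.inf_right (h.mono inf_le_left hst le_rfl) (h.mono inf_le_right hru le_rfl)

variable [IsStrictOrderedRing D]

theorem algebraMap_prox (h : IsProximity D prox) (a : D) :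
    prox (algebraMap D S a) (algebraMap D S a) := by
  have hpos : ∀ a : D, 0 < a → prox (algebraMap D S a) (algebraMap D S a) := fun a ha => by
    simpa [Algebra.algebraMap_eq_smul_one] using h.smul h.one_prox a ha
  rcases lt_trichotomy a 0 with ha | rfl | ha
  · simpa using h.neg (hpos (-a) (neg_pos.2 ha))
  · simpa using h.zero_prox
  · exact hpos a ha

variable {A : Type w} [BooleanAlgebra A]

theorem sup (h : IsProximity D prox) (R : FunctionRepresentation D S A) {s t r u : S}
    (hst : prox s t) (hru : prox r u) : prox (s ⊔ r) (t ⊔ u) := by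
  have key : ∀ s r : S, s ⊔ r = -(-s ⊓ -r) := fun s r => R.ext_ev fun x => by
    simp [min_neg_neg]
  rw [key, key t]
  exact h.neg (h.inf (h.neg hst) (h.neg hru))

theorem ind_flat (h : IsProximity D prox) (R : FunctionRepresentation D S A) {s t : S}
    (hst : prox s t) (a : D) :
    prox (R.ind (R.flat s a)) (R.ind (R.flat t a)) := by
  classical
  obtain ⟨b, hba, hb⟩ := (R.vals s ∪ R.vals t).exists_lt_forall_mem_le_of_lt a
  refine h.of_smul (a - b) (sub_pos.2 hba) ?_
  rw [R.smul_ind_flat hba fun v hv => hb v (Finset.mem_union_left _ hv),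
    R.smul_ind_flat hba fun v hv => hb v (Finset.mem_union_right _ hv)]
  exact h.add (h.sup R (h.inf hst (h.algebraMap_prox a)) (h.algebraMap_prox b))
    (h.algebraMap_prox (-b))

/-- The elements `s ∧ c` are built up by induction on the number of values below `c`: if `b` is the
largest of them, then `s ∧ c = (s ∧ b) + (c - b) [c ≤ s]`. -/
theorem of_ind_flat (h : IsProximity D prox) (R : FunctionRepresentation D S A) {s t : S}
    (hst : ∀ a, prox (R.ind (R.flat s a)) (R.ind (R.flat t a))) : prox s t := by
  classical
  set F := R.vals s ∪ R.vals t
  have key : ∀ (n : ℕ) (c : D), (F.filter (· < c)).card = n →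
      prox (s ⊓ algebraMap D S c) (t ⊓ algebraMap D S c) := by
    intro n
    induction n using Nat.strong_induction_on with
    | _ n ih =>
      intro c hc
      by_cases hne : (F.filter (· < c)).Nonempty
      · set b := (F.filter (· < c)).max' hne
        obtain ⟨hbF, hbc⟩ := Finset.mem_filter.1 (Finset.max'_mem _ hne)
        have hb : ∀ v ∈ F, v < c → v ≤ b := fun v hv hvc => Finset.le_max' _ _ (by simp [*])
        have hlt : (F.filter (· < b)).card < n := by
          rw [← hc]
          refine Finset.card_lt_card ((Finset.ssubset_iff_of_subset ?_).2 ⟨b, ?_, ?_⟩)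
          · intro v hv
            simp only [Finset.mem_filter] at hv ⊢
            exact ⟨hv.1, hv.2.trans hbc⟩
          · exact Finset.max'_mem _ hne
          · simp
        have hdec : ∀ r : S, (∀ v ∈ R.vals r, v ∈ F) → r ⊓ algebraMap D S c =
            r ⊓ algebraMap D S b + (c - b) • R.ind (R.flat r c) := fun r hr => R.ext_ev fun x => by
          simp only [R.ev_smul, R.ev_ind, R.mem_φ_flat, map_add, Pi.add_apply, R.ev_inf,
            R.ev_algebraMap]
          by_cases hx : c ≤ R.ev r x
          · have : b ≤ R.ev r x := hbc.le.trans hx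
            simp [hx, this]
          · have := hb _ (hr _ (R.ev_mem_vals r x)) (not_le.1 hx)
            simp [hx, this, (not_le.1 hx).le]
        rw [hdec s fun v hv => Finset.mem_union_left _ hv,
          hdec t fun v hv => Finset.mem_union_right _ hv]
        exact h.add (ih _ hlt b rfl) (h.smul (hst c) _ (sub_pos.2 hbc))
      · have hconst : ∀ r : S, (∀ v ∈ R.vals r, v ∈ F) → r ⊓ algebraMap D S c = algebraMap D S c :=
          fun r hr => R.ext_ev fun x => by
            have : c ≤ R.ev r x := not_lt.1 fun hlt =>
              hne ⟨_, Finset.mem_filter.2 ⟨hr _ (R.ev_mem_vals r x), hlt⟩⟩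
            simp [this]
        rw [hconst s fun v hv => Finset.mem_union_left _ hv,
          hconst t fun v hv => Finset.mem_union_right _ hv]
        exact h.algebraMap_prox c
  obtain ⟨m, hm⟩ := F.bddAbove
  have hm' : ∀ r : S, (∀ v ∈ R.vals r, v ∈ F) → r ⊓ algebraMap D S m = r := fun r hr =>
    R.ext_ev fun x => by
      have : R.ev r x ≤ m := hm (hr _ (R.ev_mem_vals r x))
      simp [this]
  have := key _ m rfl
  rwa [hm' s fun v hv => Finset.mem_union_left _ hv,
    hm' t fun v hv => Finset.mem_union_right _ hv] at this

end IsProximity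

section Idempotents

variable {D : Type u} [CommRing D] [LinearOrder D] [IsStrictOrderedRing D]

theorem spectralRepresentation_ind {S : Type (max u v)} [CommRing S] [Algebra D S] [Lattice S]
    (hS : IsSpeckerAlgebra D S) (hF : IsFAlgebra D S) (e : {e : S // IsIdempotentElem e}) :
    (spectralRepresentation hS hF).ind e = e :=
  (spectralRepresentation hS hF).ext_ev fun χ => by
    rw [FunctionRepresentation.ev_ind]
    exact (IsSpeckerAlgebra.algHom_apply_idempotent χ e).symm

namespace PBSp

variable (S : PBSp.{u, max u v} D)

theorem isDeVriesProximity_idempotents : IsDeVriesProximity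
    (fun e f : {e : S // IsIdempotentElem e} => S.prox e f) := by
  have hp := S.isProximity
  let R := spectralRepresentation S.isSpeckerAlgebra S.isFAlgebra
  have hR : ∀ e, R.ind e = e := spectralRepresentation_ind _ _
  have hle : ∀ {e f : {e : S // IsIdempotentElem e}}, (e : S) * f = e ↔ (e : S) ≤ f :=
    fun {e f} => by rw [← hR e, ← hR f, ← inf_eq_left, ← R.ind_inf, R.ind_mul]
  have hcompl : ∀ e : {e : S // IsIdempotentElem e}, ((eᶜ : {e : S // IsIdempotentElem e}) : S) =
      -(e : S) + 1 := fun e => by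
    rw [← hR eᶜ, R.ind_compl, hR e]; ring
  exact
    { top_prox := hp.one_prox
      le_of_prox := fun h => hle.2 (hp.le_of_prox h)
      mono := fun h₁ h h₂ => hp.mono (hle.1 h₁) h (hle.1 h₂)
      inf_right := fun {a b c} h₁ h₂ => by
        have := hp.inf_right h₁ h₂
        rwa [← hR b, ← hR c, ← R.ind_inf, hR] at this
      compl := fun {a b} h => by
        rw [hcompl, hcompl]
        exact hp.add (hp.neg h) hp.one_prox
      interpolate := fun {a b} h => by
        obtain ⟨r, h₁, h₂⟩ := hp.interpolate h
        have h₁' := hp.ind_flat R h₁ 1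
        have h₂' := hp.ind_flat R h₂ 1
        rw [R.ind_flat_one_of_isIdempotentElem a.2, hR] at h₁'
        rw [R.ind_flat_one_of_isIdempotentElem b.2, hR] at h₂'
        exact ⟨R.flat r 1, h₁', h₂'⟩
      exists_prox := fun {a} ha => by
        have ha0 : (0 : S) < a := lt_of_le_of_ne (S.isFAlgebra.nonneg_of_isIdempotentElem a.2)
          fun h => ha (Subtype.ext h.symm)
        obtain ⟨t, ht0, ht⟩ := hp.exists_prox ha0
        obtain ⟨x, hx⟩ : ∃ x, 0 < R.ev t x := by
          by_contra! hx
          exact ht0.not_ge (R.le_iff.2 fun x => by simpa using hx x)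
        refine ⟨R.flat t (R.ev t x), fun h => R.not_mem_φ_bot (x := x) ?_, ?_⟩
        · rw [← h]
          simp
        · have := hp.ind_flat R ht (R.ev t x)
          rw [hR, hR, ← hR a, R.flat_ind, if_neg hx.not_ge] at this
          refine hp.mono le_rfl this ?_
          rw [← hle]
          split_ifs
          exacts [a.2, zero_mul _] }

/-- The de Vries algebra of idempotents. -/
noncomputable def idempotents : DeV.{max u v} :=
  letI := S.isBaerRing.completeBooleanAlgebra
  { carrier := {e : S // IsIdempotentElem e}
    prox := fun e f => S.prox e f
    isDeVriesProximity := S.isDeVriesProximity_idempotents }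

/-- The representation of `S` over its de Vries algebra of idempotents. -/
noncomputable def idempotentsRepresentation : ProximityRepresentation S S.idempotents :=
  { toFunctionRepresentation := spectralRepresentation S.isSpeckerAlgebra S.isFAlgebra
    prox_iff' := fun s t => by
      have hR : ∀ e, (spectralRepresentation S.isSpeckerAlgebra S.isFAlgebra).ind e = e :=
        spectralRepresentation_ind _ _
      refine ⟨fun h a => ?_, fun h => S.isProximity.of_ind_flat
        (spectralRepresentation S.isSpeckerAlgebra S.isFAlgebra) fun a => ?_⟩
      · have := S.isProximity.ind_flat
          (spectralRepresentation S.isSpeckerAlgebra S.isFAlgebra) h a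
        rwa [hR, hR] at this
      · rw [hR, hR]
        exact h a }

theorem idempotentsRepresentation_ind (e : S.idempotents) :
    S.idempotentsRepresentation.ind e = e.1 :=
  spectralRepresentation_ind S.isSpeckerAlgebra S.isFAlgebra e

/-- The idempotents of `S` form the de Vries algebra `S.idempotents`. -/
noncomputable def idempotentsPresentation : IdempotentsPresentation S S.idempotents where
  idem := Equiv.refl _
  le_iff x y := by
    change x ≤ y ↔ x.1 * y.1 = x.1
    exact Iff.rfl
  prox_iff _ _ := Iff.rfl

end PBSp

end Idempotents

/-! ### Algebras of simple functions are Baer-Specker algebras -/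

namespace FunctionRepresentation

variable {D : Type u} [CommRing D] [LinearOrder D]
  {S : Type w} [CommRing S] [Algebra D S] [Lattice S]

section Algebra

variable {A : Type w} [BooleanAlgebra A] (R : FunctionRepresentation D S A)

theorem eq_sum_smul_ind (s : S) : s = ∑ a ∈ R.vals s, a • R.ind (R.lev s {a}) := by
  classical
  refine R.ext_ev fun x => ?_
  have : ∀ a, R.ev (a • R.ind (R.lev s {a})) x = if R.ev s x = a then a else 0 := fun a => by
    by_cases h : R.ev s x = a <;> simp [ev_ind, h]
  rw [map_sum, Finset.sum_apply, Finset.sum_congr rfl fun a _ => this a, Finset.sum_ite_eq,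
    if_pos (R.ev_mem_vals s x)]

theorem isTorsionFree (R : FunctionRepresentation D S A) : Module.IsTorsionFree D S where
  isSMulRegular a ha s t h := by
    refine R.ext_ev fun x => ha.left ?_
    change a * R.ev s x = a * R.ev t x
    rw [← ev_smul, ← ev_smul]
    exact congrArg (fun r => R.ev r x) h

theorem adjoin_isIdempotentElem_eq_top (R : FunctionRepresentation D S A) :
    Algebra.adjoin D {e : S | IsIdempotentElem e} = ⊤ := by
  rw [eq_top_iff]
  intro s _
  rw [R.eq_sum_smul_ind s]
  refine Subalgebra.sum_mem _ fun a _ => Subalgebra.smul_mem _ ?_ a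
  exact Algebra.subset_adjoin (R.isIdempotentElem_ind _)

theorem isSpeckerAlgebra (R : FunctionRepresentation D S A) : IsSpeckerAlgebra D S :=
  ⟨R.adjoin_isIdempotentElem_eq_top, R.isTorsionFree⟩

theorem zero_le_iff {s : S} : 0 ≤ s ↔ ∀ x, 0 ≤ R.ev s x := by
  simp [R.le_iff]

theorem isFAlgebra [IsStrictOrderedRing D] (R : FunctionRepresentation D S A) :
    IsFAlgebra D S where
  add_le_add_right h r := R.le_iff.2 fun x => by
    simpa using R.le_iff.1 h x
  mul_nonneg hs ht := R.zero_le_iff.2 fun x => by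
    simpa using mul_nonneg (R.zero_le_iff.1 hs x) (R.zero_le_iff.1 ht x)
  mul_inf_eq_zero {r s t} h hr := R.ext_ev fun x => by
    have hx : min (R.ev s x) (R.ev t x) = 0 := by rw [← ev_inf, h, map_zero]; rfl
    have hrx := R.zero_le_iff.1 hr x
    simp only [ev_inf, map_mul, Pi.mul_apply, map_zero, Pi.zero_apply]
    rcases min_eq_iff.1 hx with ⟨hs, ht⟩ | ⟨ht, hs⟩
    · rw [hs] at ht
      rw [hs, mul_zero, min_eq_left ht]
    · rw [ht] at hs
      rw [ht, min_eq_right (mul_nonneg hrx hs)]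
  smul_nonneg ha hs := R.zero_le_iff.2 fun x => by
    simpa using mul_nonneg ha (R.zero_le_iff.1 hs x)

/-- The annihilator of an ideal is generated by the complement of the join of the supports. -/
theorem isBaerRing [IsDomain D] {A : Type w} [CompleteBooleanAlgebra A]
    (R : FunctionRepresentation D S A) : IsBaerRing S := by
  intro I
  refine ⟨R.ind (⨆ s ∈ I, R.lev s {0}ᶜ)ᶜ, R.isIdempotentElem_ind _, ?_⟩
  set u : A := ⨆ s ∈ I, R.lev s {0}ᶜ
  ext t
  rw [Submodule.mem_annihilator, Ideal.mem_span_singleton']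
  constructor
  · intro ht
    have hu : u ≤ R.lev t {0} := iSup₂_le fun s hs => R.φ_le_iff.2 fun x hx => by
      have hts := congrArg (fun r => R.ev r x) (ht s hs)
      simp only [smul_eq_mul, map_mul, Pi.mul_apply, map_zero, Pi.zero_apply, mul_eq_zero] at hts
      rw [mem_φ_lev] at hx ⊢
      exact hts.resolve_right hx
    refine ⟨t, R.ext_ev fun x => ?_⟩
    by_cases hx : x ∈ R.φ u
    · have : R.ev t x = 0 := R.mem_φ_lev.1 (R.φ_mono hu hx)
      simp [this]
    · simp [ev_ind, hx]
  · rintro ⟨r, rfl⟩ s hs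
    refine R.ext_ev fun x => ?_
    by_cases hx : x ∈ R.φ u
    · simp [ev_ind, hx]
    · have : R.ev s x = 0 := by
        by_contra h
        exact hx (R.φ_mono (le_iSup₂_of_le s hs le_rfl) (R.mem_φ_lev.2 h))
      simp [this]

end Algebra

section Proximity

variable {A : DeV.{w}} (R : FunctionRepresentation D S A)

/-- A finite union of sets that are proximal to `b` is proximal to `b`. -/
theorem prox_of_forall_mem {ι : Type*} (I : Finset ι) (c : ι → A) {a b : A}
    (hc : ∀ i ∈ I, A.prox (c i) b) (ha : ∀ x ∈ R.φ a, ∃ i ∈ I, x ∈ R.φ (c i)) : A.prox a b := by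
  classical
  have hsup : ∀ J ⊆ I, A.prox (J.sup c) b := fun J => by
    induction J using Finset.induction_on with
    | empty => exact fun _ => A.isDeVries.bot_prox b
    | insert i J _ ih =>
      intro hJ
      rw [Finset.insert_subset_iff] at hJ
      rw [Finset.sup_insert]
      exact A.isDeVries.sup_left (hc i hJ.1) (ih hJ.2)
  refine A.isDeVries.mono (R.φ_le_iff.2 fun x hx => ?_) (hsup I subset_rfl) le_rfl
  obtain ⟨i, hi, hxi⟩ := ha x hx
  exact R.φ_mono (Finset.le_sup hi) hxi

/-- The pointwise proximity of the functions `flat s` and `flat t`. -/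
def FlatProx (s t : S) : Prop := ∀ a, A.prox (R.flat s a) (R.flat t a)

variable {R}

/-- The pointwise proximity is preserved by operations that are monotone on the values of the
smaller elements. -/
theorem FlatProx.map₂ {s t r u v w : S} (hst : R.FlatProx s t) (hru : R.FlatProx r u)
    {F : D → D → D} (hF : ∀ b ∈ R.vals s, ∀ c ∈ R.vals r, ∀ b' c', b ≤ b' → c ≤ c' →
      F b c ≤ F b' c') (hv : ∀ x, R.ev v x = F (R.ev s x) (R.ev r x))
    (hw : ∀ x, R.ev w x = F (R.ev t x) (R.ev u x)) : R.FlatProx v w := fun a => by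
  classical
  refine R.prox_of_forall_mem ((R.vals s ×ˢ R.vals r).filter fun p => a ≤ F p.1 p.2)
    (fun p => R.flat s p.1 ⊓ R.flat r p.2) (fun p hp => ?_) fun x hx => ?_
  · obtain ⟨hp, ha⟩ := Finset.mem_filter.1 hp
    obtain ⟨h₁, h₂⟩ := Finset.mem_product.1 hp
    refine A.isDeVries.mono le_rfl (A.isDeVries.inf (hst p.1) (hru p.2))
      (R.φ_le_iff.2 fun x hx => ?_)
    simp only [mem_φ_inf, mem_φ_flat] at hx ⊢
    rw [hw]
    exact ha.trans (hF _ h₁ _ h₂ _ _ hx.1 hx.2)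
  · rw [mem_φ_flat, hv] at hx
    exact ⟨(R.ev s x, R.ev r x), by simpa [R.ev_mem_vals] using hx, by simp⟩

theorem flatProx_zero : R.FlatProx 0 0 := fun a => by
  have := R.flat_algebraMap 0 a
  rw [map_zero] at this
  rw [this]
  split_ifs
  exacts [A.isDeVries.top_prox, A.isDeVries.bot_prox _]

theorem flatProx_one : R.FlatProx 1 1 := fun a => by
  have := R.flat_algebraMap 1 a
  rw [map_one] at this
  rw [this]
  split_ifs
  exacts [A.isDeVries.top_prox, A.isDeVries.bot_prox _]

/-- Values of an interpolating function have to be chosen only at the finitely many values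
of `s`. -/
theorem FlatProx.interpolate {s t : S} (h : R.FlatProx s t) :
    ∃ r, R.FlatProx s r ∧ R.FlatProx r t := by
  choose c hc using fun a => A.isDeVries.interpolate (h a)
  obtain ⟨m, hm⟩ := R.exists_flat_eq_top t
  obtain ⟨r, hr⟩ := R.exists_flat_eq_sup (R.vals s) m id c
  refine ⟨r, fun a => ?_, fun a => ?_⟩
  · rw [hr]
    split_ifs with ha
    · exact A.isDeVries.prox_top _
    · refine R.prox_of_forall_mem ((R.vals s).filter (a ≤ ·)) (R.flat s) (fun v hv => ?_)
        fun x hx => ?_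
      · exact A.isDeVries.mono le_rfl (hc v).1 (Finset.le_sup hv)
      · rw [mem_φ_flat] at hx
        exact ⟨R.ev s x, by simpa [R.ev_mem_vals] using hx, by simp⟩
  · rw [hr]
    split_ifs with ha
    · have : R.flat t a = ⊤ := top_le_iff.1 (hm ▸ R.flat_antitone t ha)
      rw [this]
      exact A.isDeVries.top_prox
    · refine R.prox_of_forall_mem ((R.vals s).filter (a ≤ ·)) c (fun v hv => ?_) fun x hx => ?_
      · exact A.isDeVries.mono le_rfl (hc v).2 (R.flat_antitone t (Finset.mem_filter.1 hv).2)
      · simpa using hx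

theorem exists_flatProx {s : S} (hs : 0 < s) : ∃ t, 0 < t ∧ R.FlatProx t s := by
  obtain ⟨x, hx⟩ : ∃ x, 0 < R.ev s x := by
    by_contra! hx
    exact hs.not_ge (R.le_iff.2 fun x => by simpa using hx x)
  obtain ⟨b, hb, hbp⟩ := A.isDeVries.exists_prox (a := R.flat s (R.ev s x)) fun h =>
    R.not_mem_φ_bot (x := x) (by rw [← h]; simp)
  refine ⟨R.step 0 (R.ev s x) b, lt_of_le_not_ge (R.zero_le_iff.2 fun y => ?_) fun h => ?_,
    fun c => ?_⟩
  · rw [ev_step]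
    split_ifs
    exacts [hx.le, le_rfl]
  · refine hb (R.φ_ext fun y => iff_of_false (fun hy => ?_) R.not_mem_φ_bot)
    have := R.le_iff.1 h y
    rw [ev_step, if_pos hy] at this
    simp only [map_zero, Pi.zero_apply] at this
    exact hx.not_ge this
  · rw [R.flat_step hx.le]
    split_ifs with h₁ h₂
    · have : R.flat s c = ⊤ := R.φ_ext fun y => by
        simpa using h₁.trans (R.zero_le_iff.1 hs.le y)
      rw [this]
      exact A.isDeVries.top_prox
    · exact A.isDeVries.mono le_rfl hbp (R.flat_antitone s h₂)
    · exact A.isDeVries.bot_prox _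

variable [IsStrictOrderedRing D]

theorem FlatProx.neg {s t : S} (h : R.FlatProx s t) : R.FlatProx (-t) (-s) := fun a => by
  classical
  have hcompl : ∀ r, R.flat (-r) a = (R.lev r (Set.Ioi (-a)))ᶜ := fun r => R.φ_ext fun x => by
    simp [le_neg]
  obtain ⟨b, hb⟩ := (R.vals s ∪ R.vals t).exists_forall_mem_iff_le_of_isUpperSet
    (isUpperSet_Ioi (-a))
  have hs : R.lev s (Set.Ioi (-a)) = R.flat s b :=
    R.lev_congr fun x => hb _ (Finset.mem_union_left _ (R.ev_mem_vals s x))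
  have ht : R.lev t (Set.Ioi (-a)) = R.flat t b :=
    R.lev_congr fun x => hb _ (Finset.mem_union_right _ (R.ev_mem_vals t x))
  rw [hcompl, hcompl, hs, ht]
  exact A.isDeVries.compl (h b)

variable (R) in
theorem isProximity_flatProx : IsProximity D R.FlatProx where
  zero_prox := flatProx_zero
  one_prox := flatProx_one
  le_of_prox h := R.le_iff_flat.2 fun a => A.isDeVries.le_of_prox (h a)
  mono h₁ h h₂ a := A.isDeVries.mono (R.flat_mono h₁ a) (h a) (R.flat_mono h₂ a)
  inf_right {s t r} h₁ h₂ a := by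
    have : R.flat (t ⊓ r) a = R.flat t a ⊓ R.flat r a := R.φ_ext fun x => by simp
    rw [this]
    exact A.isDeVries.inf_right (h₁ a) (h₂ a)
  neg h := h.neg
  add h₁ h₂ := h₁.map₂ h₂ (F := (· + ·)) (fun _ _ _ _ _ _ hb hc => add_le_add hb hc)
    (fun x => by simp) fun x => by simp
  smul h a ha := h.map₂ flatProx_zero (F := fun b _ => a * b)
    (fun _ _ _ _ _ _ hb _ => mul_le_mul_of_nonneg_left hb ha.le) (fun x => by simp)
    fun x => by simp
  of_smul {s t} a ha h b := by
    have : ∀ r, R.flat r b = R.flat (a • r) (a * b) := fun r => R.φ_ext fun x => by simp [ha]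
    rw [this, this t]
    exact h _
  mul hs _ hr _ h₁ h₂ := h₁.map₂ h₂ (F := (· * ·))
    (fun b hb c hc b' c' hbb hcc => by
      obtain ⟨x, rfl⟩ := R.exists_of_mem_vals hb
      obtain ⟨y, rfl⟩ := R.exists_of_mem_vals hc
      exact mul_le_mul hbb hcc (R.zero_le_iff.1 hr y) ((R.zero_le_iff.1 hs x).trans hbb))
    (fun x => by simp) fun x => by simp
  interpolate h := h.interpolate
  exists_prox hs := exists_flatProx hs

end Proximity

end FunctionRepresentation

/-! ### The de Vries power -/

/-- The algebra of the functions that are simple with respect to a field of sets. -/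
def simpleFunctions (D : Type u) [CommRing D] {A : Type w} [BooleanAlgebra A] {X : Type*}
    (φ : BoundedLatticeHom A (Set X)) : Subalgebra D (X → D) where
  carrier := {f | IsSimple φ f}
  mul_mem' hf hg := hf.map₂ hg (· * ·)
  add_mem' hf hg := hf.map₂ hg (· + ·)
  algebraMap_mem' a := isSimple_const a

/-- The Stone representation of a boolean algebra as a field of sets of prime ideals. -/
def stoneMap (A : Type w) [BooleanAlgebra A] :
    BoundedLatticeHom A (Set {I : Order.Ideal A // I.IsPrime}) where
  toFun a := {I | a ∉ I.1}
  map_sup' a b := by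
    ext I
    change a ⊔ b ∉ I.1 ↔ a ∉ I.1 ∨ b ∉ I.1
    rw [Order.Ideal.sup_mem_iff, not_and_or]
  map_inf' a b := by
    ext I
    change a ⊓ b ∉ I.1 ↔ a ∉ I.1 ∧ b ∉ I.1
    rw [← not_or, not_iff_not]
    exact ⟨I.2.mem_or_mem, fun h => h.elim (I.1.lower inf_le_left) (I.1.lower inf_le_right)⟩
  map_top' := by
    ext I
    exact iff_of_true I.2.toIsProper.top_notMem trivial
  map_bot' := by
    ext I
    exact iff_of_false (fun h => h I.1.bot_mem) id

theorem stoneMap_injective (A : Type w) [BooleanAlgebra A] : Function.Injective (stoneMap A) := by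
  have key : ∀ {a b : A}, stoneMap A a = stoneMap A b → a ≤ b := fun {a b} h => by
    by_contra hab
    obtain ⟨J, hJ, hbJ, hdisj⟩ := DistribLattice.prime_ideal_of_disjoint_filter_ideal
      (F := Order.PFilter.principal a) (I := Order.Ideal.principal b)
      (Set.disjoint_left.2 fun x hx hxb =>
        hab ((Order.PFilter.mem_principal.1 hx).trans (Order.Ideal.mem_principal.1 hxb)))
    have ha : a ∉ J := Set.disjoint_left.1 hdisj (Order.PFilter.mem_principal.2 le_rfl)
    have hmem : (⟨J, hJ⟩ : {I : Order.Ideal A // I.IsPrime}) ∈ stoneMap A b := by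
      rw [← h]; exact ha
    exact hmem (hbJ Order.Ideal.mem_principal_self)
  exact fun a b h => le_antisymm (key h) (key h.symm)

section Power

variable (D : Type u) [CommRing D] [LinearOrder D]

/-- Simple functions form a lattice with the pointwise operations. -/
instance simpleFunctionsLattice {A : Type w} [BooleanAlgebra A] {X : Type*}
    (φ : BoundedLatticeHom A (Set X)) : Lattice (simpleFunctions D φ) :=
  Subtype.lattice (fun _ _ hf hg => IsSimple.map₂ hf hg max) fun _ _ hf hg =>
    IsSimple.map₂ hf hg min

/-- Simple functions on the prime ideals represent themselves. -/
def simpleFunctionsRepresentation (A : Type (max u v)) [BooleanAlgebra A] :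
    FunctionRepresentation D (simpleFunctions D (stoneMap A)) A where
  X := {I : Order.Ideal A // I.IsPrime}
  φ := stoneMap A
  φ_injective := stoneMap_injective A
  ev := (simpleFunctions D (stoneMap A)).val
  isSimple s := s.2
  exists_ev_eq f hf := ⟨⟨f, hf⟩, rfl⟩
  le_iff' _ _ := Iff.rfl

variable [IsStrictOrderedRing D]

/-- The de Vries power of `D` by `A`, realized by simple functions on the prime ideals of `A`. -/
def DeV.power (A : DeV.{max u v}) : PBSp.{u, max u v} D where
  carrier := simpleFunctions D (stoneMap A)
  isSpeckerAlgebra := (simpleFunctionsRepresentation D A).isSpeckerAlgebra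
  isFAlgebra := (simpleFunctionsRepresentation D A).isFAlgebra
  isBaerRing := (simpleFunctionsRepresentation D A).isBaerRing
  prox := (simpleFunctionsRepresentation D A).FlatProx
  isProximity := (simpleFunctionsRepresentation D A).isProximity_flatProx

/-- The representation of the de Vries power of `D` by `A` over `A`. -/
def DeV.powerRepresentation (A : DeV.{max u v}) : ProximityRepresentation (A.power D) A :=
  { toFunctionRepresentation := simpleFunctionsRepresentation D A
    prox_iff' := fun _ _ => Iff.rfl }

end Power

/-! ### The category of de Vries algebras -/

namespace DeV

/-- The composite `g ⋆ f` of de Vries morphisms. -/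
def Hom.comp {A B C : DeV.{w}} (f : Hom A B) (g : Hom B C) : Hom A C where
  toFun b := sSup ((fun a : A => g (f a)) '' {a : A | A.prox a b})
  map_bot := by
    rw [sSup_eq_bot]
    rintro _ ⟨a, ha, rfl⟩
    have : a = ⊥ := le_bot_iff.1 (A.isDeVries.le_of_prox ha)
    simp only [this, f.map_bot, g.map_bot]
  map_inf b c := by
    refine le_antisymm (le_inf ?_ ?_) ?_
    · exact sSup_le_sSup (Set.image_mono fun a ha => A.isDeVries.mono le_rfl ha inf_le_left)
    · exact sSup_le_sSup (Set.image_mono fun a ha => A.isDeVries.mono le_rfl ha inf_le_right)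
    · rw [sSup_inf_sSup]
      refine iSup₂_le ?_
      rintro ⟨_, _⟩ ⟨⟨a, ha, rfl⟩, ⟨a', ha', rfl⟩⟩
      refine le_sSup ⟨a ⊓ a', A.isDeVries.inf ha ha', ?_⟩
      simp only [f.map_inf, g.map_inf]
  map_prox {a b} h := by
    obtain ⟨c, hac, hcb⟩ := A.isDeVries.interpolate h
    obtain ⟨d, hcd, hdb⟩ := A.isDeVries.interpolate hcb
    have hgf : C.prox (g (f cᶜ))ᶜ (g (f d)) := by
      have := g.map_prox (f.map_prox hcd)
      rwa [compl_compl] at this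
    exact C.isDeVries.mono (compl_le_compl (le_sSup ⟨cᶜ, A.isDeVries.compl hac, rfl⟩)) hgf
      (le_sSup ⟨d, hdb, rfl⟩)
  map_sSup b := by
    refine le_antisymm (sSup_le ?_) (sSup_le ?_)
    · rintro _ ⟨a, ha, rfl⟩
      obtain ⟨c, hac, hcb⟩ := A.isDeVries.interpolate ha
      exact le_sSup_of_le ⟨c, hcb, rfl⟩ (le_sSup ⟨a, hac, rfl⟩)
    · rintro _ ⟨c, hc, rfl⟩
      exact sSup_le_sSup (Set.image_mono fun a ha =>
        A.isDeVries.mono le_rfl ha (A.isDeVries.le_of_prox hc))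

/-- The identity morphism. -/
def Hom.id (A : DeV.{w}) : Hom A A where
  toFun a := a
  map_bot := rfl
  map_inf _ _ := rfl
  map_prox h := by rwa [compl_compl]
  map_sSup b := by rw [Set.image_id', A.sSup_prox]

namespace Hom

variable {A B C E : DeV.{w}}

theorem comp_apply_le (f : Hom A B) (g : Hom B C) (b : A) : f.comp g b ≤ g (f b) := by
  refine sSup_le ?_
  rintro _ ⟨a, ha, rfl⟩
  exact g.monotone (f.monotone (A.isDeVries.le_of_prox ha))

theorem id_comp (f : Hom A B) : (Hom.id A).comp f = f :=
  Hom.ext (funext fun b => (f.map_sSup b).symm)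

theorem comp_id (f : Hom A B) : f.comp (Hom.id B) = f :=
  Hom.ext (funext fun b => (f.map_sSup b).symm)

/-- Both ways to compose three morphisms yield `b ↦ ⋁ {h (g (f a)) : a ≺ b}`. -/
theorem comp_assoc (f : Hom A B) (g : Hom B C) (h : Hom C E) :
    (f.comp g).comp h = f.comp (g.comp h) := by
  refine Hom.ext (funext fun b => ?_)
  have h₁ : (f.comp g).comp h b = sSup ((fun a => h (g (f a))) '' {a | A.prox a b}) := by
    refine le_antisymm (sSup_le ?_) (sSup_le ?_)
    · rintro _ ⟨a, ha, rfl⟩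
      exact le_sSup_of_le ⟨a, ha, rfl⟩ (h.monotone (comp_apply_le f g a))
    · rintro _ ⟨a, ha, rfl⟩
      obtain ⟨c, hac, hcb⟩ := A.isDeVries.interpolate ha
      exact le_sSup_of_le ⟨c, hcb, rfl⟩ (h.monotone (le_sSup ⟨a, hac, rfl⟩))
  have h₂ : f.comp (g.comp h) b = sSup ((fun a => h (g (f a))) '' {a | A.prox a b}) := by
    refine le_antisymm (sSup_le ?_) (sSup_le ?_)
    · rintro _ ⟨a, ha, rfl⟩
      exact le_sSup_of_le ⟨a, ha, rfl⟩ (comp_apply_le g h (f a))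
    · rintro _ ⟨a, ha, rfl⟩
      obtain ⟨c, hac, hcb⟩ := A.isDeVries.interpolate ha
      exact le_sSup_of_le ⟨c, hcb, rfl⟩ (le_sSup ⟨f a, f.prox hac, rfl⟩)
  exact h₁.trans h₂.symm

end Hom

/-- The category of de Vries algebras. -/
def categoryStructure : DeV.CategoryStructure.{w} where
  id := Hom.id
  isId_id _ _ := rfl
  comp := Hom.comp
  isComp_comp _ _ _ := rfl
  id_comp := Hom.id_comp
  comp_id := Hom.comp_id
  assoc := Hom.comp_assoc

end DeV

/-! ### The category of proximity Baer-Specker algebras -/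

namespace ProximityRepresentation

variable {D : Type u} [CommRing D] [LinearOrder D] [IsStrictOrderedRing D]
  {S T U : PBSp.{u, w} D} {A B C : DeV.{w}}
  {R : ProximityRepresentation S A} {Q : ProximityRepresentation T B}
  {P : ProximityRepresentation U C}

theorem toDeVHom_eq {f : PBSp.Hom S T} {σ : DeV.Hom A B} (h : Represents R Q f σ) :
    toDeVHom R Q f = σ :=
  DeV.Hom.ext ((represents_toDeVHom f).eq_right h)

theorem toDeVHom_ofDeVHom (σ : DeV.Hom A B) : toDeVHom R Q (ofDeVHom R Q σ) = σ :=
  toDeVHom_eq (represents_ofDeVHom σ)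

theorem toDeVHom_injective (R : ProximityRepresentation S A) (Q : ProximityRepresentation T B) :
    Function.Injective (toDeVHom R Q) := fun f g h =>
  PBSp.Hom.ext ((represents_toDeVHom f).eq_left (h ▸ represents_toDeVHom g))

/-- Composites of proximity morphisms correspond to composites of de Vries morphisms, for any choice
of representations. -/
theorem isComp_iff {f : PBSp.Hom S T} {g : PBSp.Hom T U} {h : PBSp.Hom S U} :
    PBSp.IsComp f g h ↔ toDeVHom R P h = (toDeVHom R Q f).comp (toDeVHom Q P g) := by
  have hlub : ∀ (k : PBSp.Hom S U), toDeVHom R P k = (toDeVHom R Q f).comp (toDeVHom Q P g) →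
      PBSp.IsComp f g k := fun k hk t =>
    ((represents_toDeVHom f).comp (represents_toDeVHom g)).isLUB
      ((toDeVHom Q P g).monotone.comp (toDeVHom R Q f).monotone)
      (σ := (toDeVHom R Q f).comp (toDeVHom Q P g)) (fun _ => rfl) fun a => by
        rw [← hk]
        exact represents_toDeVHom k t a
  refine ⟨fun hc => ?_, hlub h⟩
  have hk := toDeVHom_ofDeVHom (R := R) (Q := P) ((toDeVHom R Q f).comp (toDeVHom Q P g))
  rw [← hk]
  congr 1
  exact PBSp.Hom.ext (funext fun t => (hc t).unique (hlub _ hk t))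

end ProximityRepresentation

section Equivalence

open ProximityRepresentation CategoryTheory

variable (D : Type u) [CommRing D] [LinearOrder D] [IsStrictOrderedRing D]

/-- The identity morphism. -/
noncomputable def PBSp.Hom.id (S : PBSp.{u, max u v} D) : PBSp.Hom S S :=
  ofDeVHom S.idempotentsRepresentation S.idempotentsRepresentation (DeV.Hom.id S.idempotents)

variable {D} in
theorem PBSp.Hom.id_apply {S : PBSp.{u, max u v} D} (s : S) : PBSp.Hom.id D S s = s :=
  S.idempotentsRepresentation.flat_injective (funext fun a => represents_ofDeVHom _ s a)

variable {D} in
theorem PBSp.Hom.toDeVHom_id {S : PBSp.{u, max u v} D} {A : DeV.{max u v}}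
    (R : ProximityRepresentation S A) : toDeVHom R R (PBSp.Hom.id D S) = DeV.Hom.id A :=
  toDeVHom_eq fun s a => by rw [PBSp.Hom.id_apply]; rfl

variable {D} in
/-- The composite `g ⋆ f` of proximity morphisms. -/
noncomputable def PBSp.Hom.comp {S T U : PBSp.{u, max u v} D} (f : PBSp.Hom S T)
    (g : PBSp.Hom T U) : PBSp.Hom S U :=
  ofDeVHom S.idempotentsRepresentation U.idempotentsRepresentation
    ((toDeVHom S.idempotentsRepresentation T.idempotentsRepresentation f).comp
      (toDeVHom T.idempotentsRepresentation U.idempotentsRepresentation g))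

variable {D} in
theorem PBSp.Hom.isComp_comp {S T U : PBSp.{u, max u v} D} (f : PBSp.Hom S T)
    (g : PBSp.Hom T U) : PBSp.IsComp f g (f.comp g) :=
  isComp_iff.2 (toDeVHom_ofDeVHom _)

variable {D} in
theorem PBSp.Hom.toDeVHom_comp {S T U : PBSp.{u, max u v} D} {A B C : DeV.{max u v}}
    (R : ProximityRepresentation S A) (Q : ProximityRepresentation T B)
    (P : ProximityRepresentation U C) (f : PBSp.Hom S T) (g : PBSp.Hom T U) :
    toDeVHom R P (f.comp g) = (toDeVHom R Q f).comp (toDeVHom Q P g) :=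
  isComp_iff.1 (f.isComp_comp g)

/-- The category of proximity Baer-Specker algebras. -/
noncomputable def PBSp.categoryStructure : PBSp.CategoryStructure.{u, max u v} D where
  id := PBSp.Hom.id D
  isId_id _ := PBSp.Hom.id_apply
  comp := PBSp.Hom.comp
  isComp_comp := PBSp.Hom.isComp_comp
  id_comp {S T} f := toDeVHom_injective S.idempotentsRepresentation T.idempotentsRepresentation (by
    rw [PBSp.Hom.toDeVHom_comp _ S.idempotentsRepresentation, PBSp.Hom.toDeVHom_id,
      DeV.Hom.id_comp])
  comp_id {S T} f := toDeVHom_injective S.idempotentsRepresentation T.idempotentsRepresentation (by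
    rw [PBSp.Hom.toDeVHom_comp _ T.idempotentsRepresentation, PBSp.Hom.toDeVHom_id,
      DeV.Hom.comp_id])
  assoc {S T U V} f g h := toDeVHom_injective S.idempotentsRepresentation
    V.idempotentsRepresentation (by
      rw [PBSp.Hom.toDeVHom_comp _ U.idempotentsRepresentation,
        PBSp.Hom.toDeVHom_comp _ T.idempotentsRepresentation,
        PBSp.Hom.toDeVHom_comp _ T.idempotentsRepresentation,
        PBSp.Hom.toDeVHom_comp _ U.idempotentsRepresentation, DeV.Hom.comp_assoc])

/-! ### The equivalence -/

noncomputable local instance : Category (PBSp.{u, max u v} D) :=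
  (PBSp.categoryStructure D).toCategory

local instance : Category DeV.{w} := DeV.categoryStructure.toCategory

/-- The functor `Id`. -/
noncomputable def idempotentsFunctor : PBSp.{u, max u v} D ⥤ DeV.{max u v} where
  obj S := S.idempotents
  map {S T} f := toDeVHom S.idempotentsRepresentation T.idempotentsRepresentation f
  map_id _ := PBSp.Hom.toDeVHom_id _
  map_comp f g := PBSp.Hom.toDeVHom_comp _ _ _ f g

/-- The de Vries power functor. -/
noncomputable def powerFunctor : DeV.{max u v} ⥤ PBSp.{u, max u v} D where
  obj A := A.power D
  map {A B} σ := ofDeVHom (A.powerRepresentation D) (B.powerRepresentation D) σ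
  map_id A := toDeVHom_injective (A.powerRepresentation D) (A.powerRepresentation D)
    ((toDeVHom_ofDeVHom _).trans (PBSp.Hom.toDeVHom_id _).symm)
  map_comp {A B C} σ τ := toDeVHom_injective (A.powerRepresentation D) (C.powerRepresentation D)
    ((toDeVHom_ofDeVHom _).trans (by
      refine Eq.trans ?_ (PBSp.Hom.toDeVHom_comp _ (B.powerRepresentation D) _ _ _).symm
      rw [toDeVHom_ofDeVHom, toDeVHom_ofDeVHom]
      rfl))

/-- Two representations of the same algebra have isomorphic de Vries algebras. -/
noncomputable def representationIso {S : PBSp.{u, max u v} D} {A B : DeV.{max u v}}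
    (R : ProximityRepresentation S A) (Q : ProximityRepresentation S B) : A ≅ B where
  hom := toDeVHom R Q (PBSp.Hom.id D S)
  inv := toDeVHom Q R (PBSp.Hom.id D S)
  hom_inv_id := by
    refine (PBSp.Hom.toDeVHom_comp R Q R _ _).symm.trans ?_
    exact (congrArg _ ((PBSp.categoryStructure D).id_comp _)).trans (PBSp.Hom.toDeVHom_id R)
  inv_hom_id := by
    refine (PBSp.Hom.toDeVHom_comp Q R Q _ _).symm.trans ?_
    exact (congrArg _ ((PBSp.categoryStructure D).id_comp _)).trans (PBSp.Hom.toDeVHom_id Q)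

/-- Two algebras represented over the same de Vries algebra are isomorphic. -/
noncomputable def algebraIso {S T : PBSp.{u, max u v} D} {A : DeV.{max u v}}
    (R : ProximityRepresentation S A) (Q : ProximityRepresentation T A) : S ≅ T where
  hom := ofDeVHom R Q (DeV.Hom.id A)
  inv := ofDeVHom Q R (DeV.Hom.id A)
  hom_inv_id := toDeVHom_injective R R (by
    refine (PBSp.Hom.toDeVHom_comp R Q R _ _).trans ?_
    rw [toDeVHom_ofDeVHom, toDeVHom_ofDeVHom, DeV.Hom.id_comp]
    exact (PBSp.Hom.toDeVHom_id R).symm)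
  inv_hom_id := toDeVHom_injective Q Q (by
    refine (PBSp.Hom.toDeVHom_comp Q R Q _ _).trans ?_
    rw [toDeVHom_ofDeVHom, toDeVHom_ofDeVHom, DeV.Hom.id_comp]
    exact (PBSp.Hom.toDeVHom_id Q).symm)

variable {D} in
/-- Naturality of the isomorphisms between the algebras and the de Vries powers of `D` by their
idempotents. -/
theorem comp_ofDeVHom_id {S T : PBSp.{u, max u v} D} (f : PBSp.Hom S T) :
    f.comp (ofDeVHom T.idempotentsRepresentation (T.idempotents.powerRepresentation D)
        (DeV.Hom.id _)) =
      (ofDeVHom S.idempotentsRepresentation (S.idempotents.powerRepresentation D)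
        (DeV.Hom.id _)).comp
      (ofDeVHom (S.idempotents.powerRepresentation D) (T.idempotents.powerRepresentation D)
        (toDeVHom S.idempotentsRepresentation T.idempotentsRepresentation f)) :=
  toDeVHom_injective S.idempotentsRepresentation (T.idempotents.powerRepresentation D) (by
    rw [PBSp.Hom.toDeVHom_comp _ T.idempotentsRepresentation,
      PBSp.Hom.toDeVHom_comp _ (S.idempotents.powerRepresentation D), toDeVHom_ofDeVHom,
      toDeVHom_ofDeVHom, toDeVHom_ofDeVHom, DeV.Hom.id_comp, DeV.Hom.comp_id])

variable {D} in
theorem PBSp.coe_toDeVHom_apply {S T : PBSp.{u, max u v} D} (f : PBSp.Hom S T)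
    (e : S.idempotents) :
    (toDeVHom S.idempotentsRepresentation T.idempotentsRepresentation f e).1 = f e.1 := by
  rw [← idempotentsRepresentation_ind T, ← idempotentsRepresentation_ind S]
  exact (map_ind f e).symm

/-- The functor `Id` and the de Vries power functor form an equivalence. -/
noncomputable def idempotentsEquivalence : PBSp.{u, max u v} D ≌ DeV.{max u v} :=
  CategoryTheory.Equivalence.mk (idempotentsFunctor D) (powerFunctor D)
    (NatIso.ofComponents
      (fun S => algebraIso D S.idempotentsRepresentation (S.idempotents.powerRepresentation D))
      fun f => comp_ofDeVHom_id f)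
    (NatIso.ofComponents
      (fun A => representationIso D (A.power D).idempotentsRepresentation (A.powerRepresentation D))
      fun {A B} σ => by
        have hσ := toDeVHom_ofDeVHom (R := A.powerRepresentation D) (Q := B.powerRepresentation D) σ
        refine (PBSp.Hom.toDeVHom_comp _ (B.power D).idempotentsRepresentation _ _ _).symm.trans
          (Eq.trans ?_ (congrArg (DeV.Hom.comp _) hσ))
        refine Eq.trans ?_ (PBSp.Hom.toDeVHom_comp _ (A.powerRepresentation D) _ _ _)
        congr 1
        exact ((PBSp.categoryStructure D).comp_id _).trans
          ((PBSp.categoryStructure D).id_comp _).symm)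

end Equivalence

theorem theorem6 (D : Type u) [CommRing D] [IsDomain D] [LinearOrder D] [IsStrictOrderedRing D] :
    ∃ (cP : PBSp.CategoryStructure.{u, max u v} D) (cD : DeV.CategoryStructure.{max u v}),
      letI := cP.toCategory
      letI := cD.toCategory
      ∃ E : PBSp.{u, max u v} D ≌ DeV.{max u v},
        Nonempty (IdempotentsFunctorPresentation E.functor.obj (fun α => E.functor.map α)) ∧
        Nonempty (DeVriesPowerFunctorPresentation E.inverse.obj (fun σ => E.inverse.map σ)) := by
  refine ⟨PBSp.categoryStructure D, DeV.categoryStructure, idempotentsEquivalence D, ⟨?_⟩, ⟨?_⟩⟩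
  · exact
      { idems := fun S => S.idempotentsPresentation
        idem_map := fun α x => PBSp.coe_toDeVHom_apply α x }
  · exact
      { power := fun A => (A.powerRepresentation D).powerPresentation
        flat_map := fun {A B} σ s => funext fun a =>
          ProximityRepresentation.represents_ofDeVHom (R := A.powerRepresentation D)
            (Q := B.powerRepresentation D) σ s a }
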